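/- Let $N\ge 1$, let $\Omega\subset\mathbb{R}^N$ be open and bounded, and let $1<p<\infty$, $s\in(0,1)$, $A>0$. Let $H=H(x,y,\xi):\mathbb{R}^N\times\mathbb{R}^N\times\mathbb{R}\to\mathbb{R}$ be a Carathéodory function (measurable in $(x,y)$ for every $\xi$, continuous in $\xi$ for a.e. $(x,y)$) that is convex in $\xi$ and satisfies $$H(x,y,\xi)\ \ge\ A\left(\frac{|\xi|}{|x-y|^s}\right)^p\qquad\text{for a.e. }(x,y)\text{ and all }\xi .$$ For measurable $\psi:\mathbb{R}^N\to\mathbb{R}$ put $$E_H(\psi)=\iint_{\mathbb{R}^N\times\mathbb{R}^N}\frac{H(x,y,\psi(x)-\psi(y))}{|x-y|^N}\,dx\,dy\in[0,\infty].$$ Let $W^{s,p}(\mathbb{R}^N)$ be the space of $\psi\in L^p(\mathbb{R}^N)$ with $\iint\frac{|\psi(x)-\psi(y)|^p}{|x-y|^{N+sp}}\,dx\,dy<\infty$, with the norm $\|\psi\|_{L^p(\mathbb{R}^N)}+\big(\iint\frac{|\psi(x)-\psi(y)|^p}{|x-y|^{N+sp}}\,dx\,dy\big)^{1/p}$, and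 let $W^{s,p}_0(\Omega)$ be its subspace of functions that vanish a.e. outside $\Omega$. Let $u_0\in W^{s,p}(\mathbb{R}^N)$ with $u_0|_\Omega\in L^2(\Omega)$ and $E_H(u_0)<\infty$. A *variational solution* is a function $u$ such that for every $T>0$: $u\in L^p(0,T;W^{s,p}(\mathbb{R}^N))\cap C([0,T];L^2(\Omega))$, $u-u_0\in L^p(0,T;W^{s,p}_0(\Omega))$, and $$\int_0^T\!\!E_H(u(\cdot,t))\,dt+\tfrac12\|(v-u)(\cdot,T)\|_{L^2(\Omega)}^2-\tfrac12\|(v-u)(\cdot,0)\|_{L^2(\Omega)}^2\ \le\ \int_0^T\!\!E_H(v(\cdot,t))\,dt+\int_0^T\!\!\int_\Omega\partial_t v\,(v-u)\,dx\,dt$$ (in $(-\infty,\infty]$) for all $v\in L^p(0,T;W^{s,p}(\mathbb{R}^N))\cap C([0,T];L^2(\Omega))$ with weak time derivative $\partial_t v\in L^2(\Omega\times(0,T))$ and $v-u_0\in L^p(0,T;W^{s,p}_0(\Omega))$. A *parabolic minimizer* is a measurable function $u:\mathbb{R}^N\times(0,\infty)\to\mathbb{R}$ such that for every $T>0$: $u\in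 L^p(0,T;W^{s,p}(\mathbb{R}^N))$, $u-u_0\in L^p(0,T;W^{s,p}_0(\Omega))$, and $$\int_0^T\!\!\int_\Omega u\,\partial_t\varphi\,dx\,dt+\int_0^T\!\!E_H(u(\cdot,t))\,dt\ \le\ \int_0^T\!\!E_H\big((u+\varphi)(\cdot,t)\big)\,dt\qquad\text{for all }\varphi\in C_c^\infty(\Omega\times(0,T)).$$ **Theorem.** Every variational solution is a parabolic minimizer. -/

import Mathlib

open MeasureTheory Set Filter Topology
open scoped ENNReal ContDiff

noncomputable section

namespace NonlocalEvolution

/-- The space `ℝ^N` with the Euclidean norm and Lebesgue measure. -/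
abbrev Space (N : ℕ) : Type := EuclideanSpace ℝ (Fin N)

/-- The measure `dx dt` on the space-time cylinder `Ω × (0,T)`; points are written `(t, x)`. -/
def cylinderMeasure {N : ℕ} (Ω : Set (Space N)) (T : ℝ) : Measure (ℝ × Space N) :=
  ((volume : Measure ℝ).restrict (Ioo 0 T)).prod ((volume : Measure (Space N)).restrict Ω)

/-! ### Fractional Sobolev spaces -/

/-- `∬ |ψ(x) - ψ(y)|^p / |x - y|^(N + s p) dx dy`, the `p`-th power of the Gagliardo seminorm of `ψ`
on `ℝ^N`. -/
def gagliardoPow {N : ℕ} (s p : ℝ) (ψ : Space N → ℝ) : ℝ≥0∞ :=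
  ∫⁻ z : Space N × Space N,
    ENNReal.ofReal (|ψ z.1 - ψ z.2| ^ p / ‖z.1 - z.2‖ ^ ((N : ℝ) + s * p))

/-- The norm `‖ψ‖_{L^p(ℝ^N)} + [ψ]_{W^{s,p}(ℝ^N)}`, with values in `[0,∞]`. -/
def sobolevNorm {N : ℕ} (s p : ℝ) (ψ : Space N → ℝ) : ℝ≥0∞ :=
  eLpNorm ψ (ENNReal.ofReal p) volume + gagliardoPow s p ψ ^ (1 / p)

/-- `ψ ∈ W^{s,p}(ℝ^N)`. -/
def MemSobolev {N : ℕ} (s p : ℝ) (ψ : Space N → ℝ) : Prop :=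
  MemLp ψ (ENNReal.ofReal p) volume ∧ gagliardoPow s p ψ < ⊤

/-- `ψ ∈ W^{s,p}_0(Ω)`: `ψ ∈ W^{s,p}(ℝ^N)` and `ψ` vanishes (almost everywhere) outside `Ω`. -/
def MemSobolevZero {N : ℕ} (Ω : Set (Space N)) (s p : ℝ) (ψ : Space N → ℝ) : Prop :=
  MemSobolev s p ψ ∧ ∀ᵐ x : Space N, x ∉ Ω → ψ x = 0

/-! ### Spaces of functions of time with values in a function space -/

/-- `u ∈ L^p(0,T; W^{s,p}(ℝ^N))`. -/
structure MemLpSobolev {N : ℕ} (s p T : ℝ) (u : ℝ → Space N → ℝ) : Prop where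
  aestronglyMeasurable : AEStronglyMeasurable (Function.uncurry u) (cylinderMeasure univ T)
  mem_sobolev : ∀ᵐ t : ℝ, t ∈ Ioo 0 T → MemSobolev s p (u t)
  lintegral_lt_top : ∫⁻ t in Ioo 0 T, sobolevNorm s p (u t) ^ p < ⊤

/-- `u ∈ L^p(0,T; W^{s,p}_0(Ω))`. -/
structure MemLpSobolevZero {N : ℕ} (Ω : Set (Space N)) (s p T : ℝ) (u : ℝ → Space N → ℝ) :
    Prop where
  memLpSobolev : MemLpSobolev s p T u
  mem_sobolevZero : ∀ᵐ t : ℝ, t ∈ Ioo 0 T → MemSobolevZero Ω s p (u t)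

/-- `u ∈ C([0,T]; L²(Ω))`. -/
structure ContinuousInL2 {N : ℕ} (Ω : Set (Space N)) (T : ℝ) (u : ℝ → Space N → ℝ) : Prop where
  memLp : ∀ t ∈ Icc 0 T, MemLp (u t) 2 (volume.restrict Ω)
  tendsto : ∀ t ∈ Icc 0 T,
    Tendsto (fun τ => eLpNorm (u τ - u t) 2 (volume.restrict Ω)) (𝓝[Icc 0 T] t) (𝓝 0)

/-- `φ ∈ C_c^∞(Ω × (0,T))`. -/
structure IsTestFunction {N : ℕ} (Ω : Set (Space N)) (T : ℝ) (φ : ℝ → Space N → ℝ) : Prop where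
  contDiff : ContDiff ℝ ∞ (Function.uncurry φ)
  hasCompactSupport : HasCompactSupport (Function.uncurry φ)
  tsupport_subset : tsupport (Function.uncurry φ) ⊆ Ioo 0 T ×ˢ Ω

/-- The classical time derivative `∂_t φ (t, x)`. -/
def timeDeriv {N : ℕ} (φ : ℝ → Space N → ℝ) (t : ℝ) (x : Space N) : ℝ :=
  deriv (fun τ => φ τ x) t

/-- The weak time derivative of `v` on `Ω × (0,T)` is `w`, and `w ∈ L²(Ω × (0,T))`. -/
structure HasWeakTimeDerivL2 {N : ℕ} (Ω : Set (Space N)) (T : ℝ) (v w : ℝ → Space N → ℝ) :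
    Prop where
  memLp : MemLp (Function.uncurry w) 2 (cylinderMeasure Ω T)
  integral_eq : ∀ φ : ℝ → Space N → ℝ, IsTestFunction Ω T φ →
    ∫ z, v z.1 z.2 * timeDeriv φ z.1 z.2 ∂(cylinderMeasure Ω T) =
      - ∫ z, w z.1 z.2 * φ z.1 z.2 ∂(cylinderMeasure Ω T)

/-! ### The nonlocal energy -/

/-- The structure conditions on `H = H(x, y, ξ)`: it is a Carathéodory function, convex in `ξ`, with
`H(x,y,ξ) ≥ A (|ξ| / |x - y|^s)^p`. -/
structure StructureCondition {N : ℕ} (s p A : ℝ) (H : Space N → Space N → ℝ → ℝ) : Prop where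
  aemeasurable : ∀ ξ : ℝ, AEMeasurable (fun z : Space N × Space N => H z.1 z.2 ξ) volume
  continuous : ∀ᵐ z : Space N × Space N, Continuous (H z.1 z.2)
  convexOn : ∀ᵐ z : Space N × Space N, ConvexOn ℝ univ (H z.1 z.2)
  lower_bound : ∀ᵐ z : Space N × Space N, ∀ ξ : ℝ,
    A * (|ξ| / ‖z.1 - z.2‖ ^ s) ^ p ≤ H z.1 z.2 ξ

/-- `∬ H(x, y, ψ(x) - ψ(y)) / |x - y|^N dx dy` over `ℝ^N × ℝ^N`, for nonnegative `H`. -/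
def energy {N : ℕ} (H : Space N → Space N → ℝ → ℝ) (ψ : Space N → ℝ) : ℝ≥0∞ :=
  ∫⁻ z : Space N × Space N, ENNReal.ofReal (H z.1 z.2 (ψ z.1 - ψ z.2) / ‖z.1 - z.2‖ ^ N)

/-- `∫_0^T ∬ H(x, y, u(x,t) - u(y,t)) / |x - y|^N dx dy dt`. -/
def timeEnergy {N : ℕ} (H : Space N → Space N → ℝ → ℝ) (T : ℝ) (u : ℝ → Space N → ℝ) : ℝ≥0∞ :=
  ∫⁻ t in Ioo 0 T, energy H (u t)

/-- The assumptions on the time-independent Cauchy-Dirichlet data `u₀`. -/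
structure IsAdmissibleDatum {N : ℕ} (Ω : Set (Space N)) (s p : ℝ)
    (H : Space N → Space N → ℝ → ℝ) (u₀ : Space N → ℝ) : Prop where
  memSobolev : MemSobolev s p u₀
  memLp : MemLp u₀ 2 (volume.restrict Ω)
  energy_lt_top : energy H u₀ < ⊤

/-! ### Variational solutions and parabolic minimizers -/

/-- `v`, with weak time derivative `w`, is an admissible comparison map on `(0,T)`. Here `v` is its
representative in `C([0,T]; L²(Ω))`, so that `v(·,0)` and `v(·,T)` have a meaning. -/
structure IsComparisonMap {N : ℕ} (Ω : Set (Space N)) (s p : ℝ) (u₀ : Space N → ℝ) (T : ℝ)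
    (v w : ℝ → Space N → ℝ) : Prop where
  memLpSobolev : MemLpSobolev s p T v
  boundary : MemLpSobolevZero Ω s p T (fun t x => v t x - u₀ x)
  continuousInL2 : ContinuousInL2 Ω T v
  weakTimeDeriv : HasWeakTimeDerivL2 Ω T v w

/-- Variational solutions. The energies lie in `[0,∞]`, so that the energy of `u` is put on the left
and the energy of `v` on the right of the inequality, which is read in the extended reals; all other
terms are finite. -/
structure IsVariationalSolution {N : ℕ} (Ω : Set (Space N)) (s p : ℝ)
    (H : Space N → Space N → ℝ → ℝ) (u₀ : Space N → ℝ) (u : ℝ → Space N → ℝ) : Prop where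
  memLpSobolev : ∀ T : ℝ, 0 < T → MemLpSobolev s p T u
  continuousInL2 : ∀ T : ℝ, 0 < T → ContinuousInL2 Ω T u
  boundary : ∀ T : ℝ, 0 < T → MemLpSobolevZero Ω s p T (fun t x => u t x - u₀ x)
  variational_inequality : ∀ T : ℝ, 0 < T → ∀ v w : ℝ → Space N → ℝ,
    IsComparisonMap Ω s p u₀ T v w →
      (timeEnergy H T u : EReal) +
          (((1 / 2) * (∫ x in Ω, (v T x - u T x) ^ 2) -
            (1 / 2) * (∫ x in Ω, (v 0 x - u 0 x) ^ 2) : ℝ) : EReal) ≤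
        (timeEnergy H T v : EReal) +
          ((∫ z, w z.1 z.2 * (v z.1 z.2 - u z.1 z.2) ∂(cylinderMeasure Ω T) : ℝ) : EReal)

/-- Parabolic minimizers. -/
structure IsParabolicMinimizer {N : ℕ} (Ω : Set (Space N)) (s p : ℝ)
    (H : Space N → Space N → ℝ → ℝ) (u₀ : Space N → ℝ) (u : ℝ → Space N → ℝ) : Prop where
  aestronglyMeasurable : AEStronglyMeasurable (Function.uncurry u)
    (((volume : Measure ℝ).restrict (Ioi 0)).prod (volume : Measure (Space N)))
  memLpSobolev : ∀ T : ℝ, 0 < T → MemLpSobolev s p T u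
  boundary : ∀ T : ℝ, 0 < T → MemLpSobolevZero Ω s p T (fun t x => u t x - u₀ x)
  minimality : ∀ T : ℝ, 0 < T → ∀ φ : ℝ → Space N → ℝ, IsTestFunction Ω T φ →
    ((∫ z, u z.1 z.2 * timeDeriv φ z.1 z.2 ∂(cylinderMeasure Ω T) : ℝ) : EReal) +
        (timeEnergy H T u : EReal) ≤
      (timeEnergy H T (fun t x => u t x + φ t x) : EReal)

end NonlocalEvolution

end

open MeasureTheory Set Filter Topology
open scoped ENNReal ContDiff

noncomputable section

namespace NonlocalEvolution

/-! The natural competitor is `u + φ`, but comparison maps need a time derivative in L², which `u`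
need not have. So `u + φ` is replaced by its exponential mollification v at scale h with initial
value a, the solution of h ∂ₜv = u + φ - v, v(0) = a (`expAverage`, `expAverage_eq_add_integral`).

Time term: put w = ∂ₜv, so that v - u = φ - h w. Since ∫ w φ = -∫ v ∂ₜφ = -∫ (u + φ - h w) ∂ₜφ and ∫
φ ∂ₜφ = 0, the term ∫ w (v - u) equals -∫ u ∂ₜφ + h ∫ (w ∂ₜφ - w²), and w ∂ₜφ - w² ≤ |∂ₜφ|² / 4. The
uncontrolled w is absorbed, and convergence of v as h → 0 is never needed (`integral_timeTerm_le`).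

Energy: v(t) averages a and the past values of `u + φ` against a probability measure. Jensen's
inequality in ξ and Tonelli bound the time-integrated energy of v by h times the energy of a plus
that of `u + φ` (`timeEnergy_expAverage_le`). By the lower bound on H, finite energy puts v in the
Sobolev class, and averaging keeps the exterior values (`isComparisonMap_expAverage`).

Initial value: u(0) is only known to lie in L²(Ω), so a = u(t₀) is taken at a small time t₀ with
finite energy and ‖u(t₀) - u(0)‖ < δ. The terminal square is dropped, the initial one costs δ²/2,
and h → 0 followed by δ → 0 gives minimality (`IsVariationalSolution.minimality`). -/

/-! ### Exponential mollification in time and its differential equation -/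

/-- A primitive of an integrable function is absolutely continuous, which suffices for integration
by parts. It serves both for the mollification equation, with ψ an exponential, and for weak time
derivatives, with ψ a test function. -/
theorem integral_primitive_mul_deriv {w ψ : ℝ → ℝ} {a T : ℝ}
    (hw : IntervalIntegrable w volume 0 T) (hψ : ContDiff ℝ 1 ψ) :
    ∫ t in 0..T, (a + ∫ s in 0..t, w s) * deriv ψ t =
      (a + ∫ s in 0..T, w s) * ψ T - a * ψ 0 - ∫ t in 0..T, w t * ψ t := by
  have hac : AbsolutelyContinuousOnInterval (fun t => a + ∫ s in 0..t, w s) 0 T := by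
    have h1 := hw.absolutelyContinuousOnInterval_intervalIntegral (c := 0) left_mem_uIcc
    have h2 : AbsolutelyContinuousOnInterval (fun _ : ℝ => a) 0 T :=
      (contDiff_const (n := 1)).contDiffOn.absolutelyContinuousOnInterval
    exact h2.add h1
  have hψ' : AbsolutelyContinuousOnInterval ψ 0 T :=
    hψ.contDiffOn.absolutelyContinuousOnInterval
  rw [hac.integral_mul_deriv_eq_deriv_mul hψ']
  have h3 : ∫ t in 0..T, deriv (fun t => a + ∫ s in 0..t, w s) t * ψ t =
      ∫ t in 0..T, w t * ψ t := by
    apply intervalIntegral.integral_congr_ae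
    filter_upwards [hw.ae_hasDerivAt_integral] with x hx hxT
    have := (hx (uIoc_subset_uIcc hxT) 0 left_mem_uIcc).const_add a
    rw [this.deriv]
  rw [h3]
  simp

/-- The exponential time mollification of `γ` at scale `h`, with initial value `a`. -/
def expAverage (h a : ℝ) (γ : ℝ → ℝ) (t : ℝ) : ℝ :=
  Real.exp (-t / h) * a + ∫ s in Ioo 0 t, 1 / h * Real.exp ((s - t) / h) * γ s

/-- Splitting the exponential kernel leaves a primitive times a smooth factor, the form to which
continuity of primitives and integration by parts apply. -/
theorem expAverage_eq_mul {h a t : ℝ} (γ : ℝ → ℝ) (ht : 0 ≤ t) :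
    expAverage h a γ t =
      (a + ∫ s in 0..t, 1 / h * Real.exp (s / h) * γ s) * Real.exp (-t / h) := by
  rw [expAverage, intervalIntegral.integral_of_le ht, integral_Ioc_eq_integral_Ioo, add_mul,
    ← integral_mul_const, mul_comm a]
  congr 2
  ext s
  rw [sub_div, sub_eq_add_neg, Real.exp_add, neg_div]
  ring

theorem intervalIntegrable_exp_mul {h T : ℝ} {γ : ℝ → ℝ}
    (hγ : IntervalIntegrable γ volume 0 T) :
    IntervalIntegrable (fun s => 1 / h * Real.exp (s / h) * γ s) volume 0 T :=
  hγ.continuousOn_mul (g := fun s => 1 / h * Real.exp (s / h)) (by fun_prop)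

theorem intervalIntegrable_expAverage {h a T : ℝ} {γ : ℝ → ℝ} (hT : 0 ≤ T)
    (hγ : IntervalIntegrable γ volume 0 T) :
    IntervalIntegrable (expAverage h a γ) volume 0 T := by
  have hc : ContinuousOn (fun t => (a + ∫ s in 0..t, 1 / h * Real.exp (s / h) * γ s) *
      Real.exp (-t / h)) (uIcc 0 T) :=
    ((continuousOn_const (c := a)).add (intervalIntegral.continuousOn_primitive_interval'
      (intervalIntegrable_exp_mul hγ) left_mem_uIcc)).mul (by fun_prop)
  have : EqOn (expAverage h a γ) (fun t => (a + ∫ s in 0..t, 1 / h * Real.exp (s / h) * γ s) *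
      Real.exp (-t / h)) (uIcc 0 T) := fun t ht => by
    rw [uIcc_of_le hT] at ht
    exact expAverage_eq_mul γ ht.1
  exact (hc.congr this).intervalIntegrable

/-- The integrated form of h v' = γ - v, v(0) = a. Integration by parts against exp(-s/h) reproduces
v itself, because the derivative of this exponential is -1/h times it, while in the other term the
two exponentials cancel. -/
theorem expAverage_eq_add_integral {h a T : ℝ} {γ : ℝ → ℝ}
    (hγ : IntervalIntegrable γ volume 0 T) {t : ℝ} (ht : t ∈ Icc 0 T) :
    expAverage h a γ t = a + ∫ s in 0..t, (γ s - expAverage h a γ s) / h := by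
  have hγt : IntervalIntegrable γ volume 0 t := hγ.mono_set (by
    rw [uIcc_of_le ht.1, uIcc_of_le (ht.1.trans ht.2)]; exact Icc_subset_Icc_right ht.2)
  have hd : ∀ s, deriv (fun s => Real.exp (-s / h)) s = - (1 / h) * Real.exp (-s / h) := by
    intro s
    have : HasDerivAt (fun s => Real.exp (-s / h)) (Real.exp (-s / h) * (-1 / h)) s :=
      ((hasDerivAt_id s).neg.div_const h).exp
    rw [this.deriv]; ring
  have key := integral_primitive_mul_deriv (a := a) (ψ := fun s => Real.exp (-s / h))
    (intervalIntegrable_exp_mul (h := h) hγt) (by fun_prop)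
  rw [← expAverage_eq_mul γ ht.1] at key
  have h1 : ∫ s in 0..t, (a + ∫ r in 0..s, 1 / h * Real.exp (r / h) * γ r) *
      deriv (fun s => Real.exp (-s / h)) s = ∫ s in 0..t, - (1 / h) * expAverage h a γ s := by
    apply intervalIntegral.integral_congr
    intro s hs
    rw [uIcc_of_le ht.1] at hs
    simp only
    rw [hd, expAverage_eq_mul γ hs.1]; ring
  have h2 : ∫ s in 0..t, 1 / h * Real.exp (s / h) * γ s * Real.exp (-s / h) =
      ∫ s in 0..t, 1 / h * γ s := by
    congr 1; ext s
    have : Real.exp (s / h) * Real.exp (-s / h) = 1 := by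
      rw [← Real.exp_add, neg_div, add_neg_cancel, Real.exp_zero]
    linear_combination (1 / h * γ s) * this
  rw [h1, h2, intervalIntegral.integral_const_mul, intervalIntegral.integral_const_mul] at key
  rw [intervalIntegral.integral_div,
    intervalIntegral.integral_sub hγt (intervalIntegrable_expAverage ht.1 hγt)]
  simp only [neg_zero, zero_div, Real.exp_zero, mul_one] at key
  linear_combination -key

theorem integral_exp_kernel {h t : ℝ} (ht : 0 ≤ t) :
    ∫ s in Ioo 0 t, 1 / h * Real.exp ((s - t) / h) = 1 - Real.exp (-t / h) := by
  rw [← integral_Ioc_eq_integral_Ioo, ← intervalIntegral.integral_of_le ht]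
  have : ∀ s ∈ uIcc 0 t, HasDerivAt (fun s => Real.exp ((s - t) / h))
      (1 / h * Real.exp ((s - t) / h)) s := fun s _ => by
    have := (((hasDerivAt_id s).sub_const t).div_const h).exp
    simpa [mul_comm] using this
  rw [intervalIntegral.integral_eq_sub_of_hasDerivAt this (by
    apply Continuous.intervalIntegrable; fun_prop)]
  simp

/-- Here the kernel is integrated in the output time t with s fixed. Mass at most 1 is what keeps
the factor 1 in front of the energy of γ after Tonelli. -/
theorem lintegral_exp_kernel_le {h s T : ℝ} (hh : 0 < h) (hs : s ≤ T) :
    ∫⁻ t in Ioo s T, ENNReal.ofReal (1 / h * Real.exp ((s - t) / h)) ≤ 1 := by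
  have hcont : Continuous fun t => 1 / h * Real.exp ((s - t) / h) := by fun_prop
  rw [← ofReal_integral_eq_lintegral_ofReal
    ((hcont.integrableOn_Icc (a := s) (b := T)).mono_set Ioo_subset_Icc_self)
    (ae_of_all _ fun t => by positivity)]
  rw [← integral_Ioc_eq_integral_Ioo, ← intervalIntegral.integral_of_le hs]
  have : ∀ t ∈ uIcc s T, HasDerivAt (fun t => - Real.exp ((s - t) / h))
      (1 / h * Real.exp ((s - t) / h)) t := fun t _ => by
    have := (((hasDerivAt_id t).const_sub s).div_const h).exp.neg
    convert! this using 1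
    simp only [id_eq]
    ring
  rw [intervalIntegral.integral_eq_sub_of_hasDerivAt this (hcont.intervalIntegrable _ _)]
  simp [Real.exp_nonneg]

/-- The weight of the initial value has total mass at most h in time, so the energy of the initial
value disappears as h → 0. It is h times the kernel at s = 0. -/
theorem lintegral_exp_neg_le {h T : ℝ} (hh : 0 < h) (hT : 0 ≤ T) :
    ∫⁻ t in Ioo 0 T, ENNReal.ofReal (Real.exp (-t / h)) ≤ ENNReal.ofReal h := by
  have := mul_le_mul_right (lintegral_exp_kernel_le hh hT) (ENNReal.ofReal h)
  rw [mul_one] at this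
  refine le_trans (le_of_eq ?_) this
  rw [← lintegral_const_mul _ (by fun_prop)]
  congr 1; ext t
  rw [← ENNReal.ofReal_mul hh.le]
  congr 1
  rw [zero_sub]; field_simp

/-! ### Jensen's inequality for the mollification -/

/-- The probability measure that represents `expAverage h · · t`. -/
def expMeasureAt (h t : ℝ) : Measure ℝ :=
  ENNReal.ofReal (Real.exp (-t / h)) • Measure.dirac 0 +
    ((volume : Measure ℝ).restrict (Ioo 0 t)).withDensity
      (fun s => ENNReal.ofReal (1 / h * Real.exp ((s - t) / h)))

theorem integrable_exp_kernel {h t : ℝ} :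
    Integrable (fun s => 1 / h * Real.exp ((s - t) / h)) (volume.restrict (Ioo 0 t)) := by
  have hcont : Continuous fun s => 1 / h * Real.exp ((s - t) / h) := by fun_prop
  exact (hcont.integrableOn_Icc (a := 0) (b := t)).mono_set Ioo_subset_Icc_self

theorem lintegral_expMeasureAt {h t : ℝ} (f : ℝ → ℝ≥0∞) :
    ∫⁻ s, f s ∂(expMeasureAt h t) = ENNReal.ofReal (Real.exp (-t / h)) * f 0 +
      ∫⁻ s in Ioo 0 t, ENNReal.ofReal (1 / h * Real.exp ((s - t) / h)) * f s := by
  rw [expMeasureAt, lintegral_add_measure, lintegral_smul_measure, lintegral_dirac,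
    lintegral_withDensity_eq_lintegral_mul_non_measurable _ (by fun_prop) (by simp)]
  simp

theorem isProbabilityMeasure_expMeasureAt {h t : ℝ} (hh : 0 < h) (ht : 0 ≤ t) :
    IsProbabilityMeasure (expMeasureAt h t) := by
  constructor
  have h1 := lintegral_expMeasureAt (h := h) (t := t) (fun _ => 1)
  rw [lintegral_one] at h1
  rw [h1]
  simp only [mul_one]
  rw [← ofReal_integral_eq_lintegral_ofReal integrable_exp_kernel
    (ae_of_all _ fun t => by positivity), integral_exp_kernel ht,
    ← ENNReal.ofReal_add (Real.exp_nonneg _)]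
  · simp
  · rw [sub_nonneg, Real.exp_le_one_iff]
    exact div_nonpos_of_nonpos_of_nonneg (by linarith) hh.le

theorem integrable_expMeasureAt {h t : ℝ} (hh : 0 < h) {f : ℝ → ℝ} (hf : Measurable f)
    (hfi : IntegrableOn f (Ioo 0 t)) : Integrable f (expMeasureAt h t) := by
  refine ⟨hf.aestronglyMeasurable, ?_⟩
  rw [HasFiniteIntegral, lintegral_expMeasureAt]
  refine ENNReal.add_lt_top.2 ⟨ENNReal.mul_lt_top (by simp) (by simp), ?_⟩
  have h1 : ∫⁻ s in Ioo 0 t, ENNReal.ofReal (1 / h * Real.exp ((s - t) / h)) * ‖f s‖ₑ ≤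
      ∫⁻ s in Ioo 0 t, ENNReal.ofReal (1 / h) * ‖f s‖ₑ := by
    refine setLIntegral_mono' measurableSet_Ioo fun s hs => ?_
    gcongr
    have : Real.exp ((s - t) / h) ≤ 1 :=
      Real.exp_le_one_iff.2 (div_nonpos_of_nonpos_of_nonneg (by linarith [hs.2]) hh.le)
    exact mul_le_of_le_one_right (by positivity) this
  refine h1.trans_lt ?_
  rw [lintegral_const_mul _ hf.enorm]
  exact ENNReal.mul_lt_top (by simp) hfi.2

theorem integral_expMeasureAt {h t : ℝ} (hh : 0 < h) {f : ℝ → ℝ} (hf : Measurable f)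
    (hfi : IntegrableOn f (Ioo 0 t)) :
    ∫ s, f s ∂(expMeasureAt h t) = expAverage h (f 0) f t := by
  have hi := integrable_expMeasureAt hh hf hfi
  rw [expMeasureAt] at hi ⊢
  rw [integral_add_measure hi.left_of_add_measure hi.right_of_add_measure, expAverage,
    integral_smul_measure, integral_dirac,
    integral_withDensity_eq_integral_toReal_smul (by fun_prop) (by simp)]
  simp only [smul_eq_mul, ENNReal.toReal_ofReal (Real.exp_nonneg _)]
  congr 2
  ext s
  rw [ENNReal.toReal_ofReal (by positivity)]

/-- Jensen's inequality for the exponential mollification. -/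
theorem ofReal_expAverage_le {h t a : ℝ} (hh : 0 < h) (ht : 0 ≤ t) {f γ : ℝ → ℝ}
    (hf : ConvexOn ℝ univ f) (hfc : Continuous f) (hf0 : ∀ ξ, 0 ≤ f ξ) (hγ : Measurable γ)
    (hγi : IntegrableOn γ (Ioo 0 t)) :
    ENNReal.ofReal (f (expAverage h a γ t)) ≤
      ENNReal.ofReal (Real.exp (-t / h)) * ENNReal.ofReal (f a) +
      ∫⁻ s in Ioo 0 t, ENNReal.ofReal (1 / h * Real.exp ((s - t) / h)) *
        ENNReal.ofReal (f (γ s)) := by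
  -- The atom at 0 would see γ(0). Resetting this one value to a makes the average an integral of a
  -- single function, and (0,t) does not notice the change.
  set γ' : ℝ → ℝ := (fun s => if s = 0 then a else γ s) with hγ'
  have hγ'm : Measurable γ' := Measurable.ite (measurableSet_singleton 0) measurable_const hγ
  have hEq : EqOn γ' γ (Ioo 0 t) := fun s hs => if_neg hs.1.ne'
  have hγ'i : IntegrableOn γ' (Ioo 0 t) := hγi.congr_fun hEq.symm measurableSet_Ioo
  have h0 : γ' 0 = a := if_pos rfl
  have hav : expAverage h a γ t = ∫ s, γ' s ∂(expMeasureAt h t) := by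
    rw [integral_expMeasureAt hh hγ'm hγ'i, h0, expAverage, expAverage]
    congr 1
    exact setIntegral_congr_fun measurableSet_Ioo fun s hs => by simp only [hEq hs]
  have hl : ENNReal.ofReal (Real.exp (-t / h)) * ENNReal.ofReal (f a) +
      ∫⁻ s in Ioo 0 t, ENNReal.ofReal (1 / h * Real.exp ((s - t) / h)) *
        ENNReal.ofReal (f (γ s)) = ∫⁻ s, ENNReal.ofReal (f (γ' s)) ∂(expMeasureAt h t) := by
    rw [lintegral_expMeasureAt, h0]
    congr 1
    exact setLIntegral_congr_fun measurableSet_Ioo fun s hs => by simp only [hEq hs]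
  rw [hav, hl]
  have := isProbabilityMeasure_expMeasureAt hh ht
  by_cases hfin : ∫⁻ s, ENNReal.ofReal (f (γ' s)) ∂(expMeasureAt h t) = ⊤
  · rw [hfin]; exact le_top
  have hint : Integrable (fun s => f (γ' s)) (expMeasureAt h t) := by
    refine ⟨(hfc.measurable.comp hγ'm).aestronglyMeasurable, ?_⟩
    rw [hasFiniteIntegral_iff_ofReal (ae_of_all _ fun s => hf0 _)]
    exact lt_top_iff_ne_top.2 hfin
  have hJ := hf.map_integral_le hfc.continuousOn isClosed_univ (ae_of_all _ fun _ => mem_univ _)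
    (integrable_expMeasureAt hh hγ'm hγ'i) hint
  refine (ENNReal.ofReal_le_ofReal hJ).trans ?_
  rw [ofReal_integral_eq_lintegral_ofReal hint (ae_of_all _ fun s => hf0 _)]

theorem measurable_expAverage {Z : Type*} [MeasurableSpace Z] (h : ℝ) {α : Z → ℝ}
    {γ : ℝ → Z → ℝ} (hα : Measurable α) (hγ : Measurable (Function.uncurry γ)) :
    Measurable fun q : ℝ × Z => expAverage h (α q.2) (fun s => γ s q.2) q.1 := by
  unfold expAverage
  refine Measurable.add (by fun_prop) ?_
  have h1 : Measurable fun r : (ℝ × Z) × ℝ => (Ioo 0 r.1.1).indicator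
      (fun s => 1 / h * Real.exp ((s - r.1.1) / h) * γ s r.1.2) r.2 := by
    have hs : MeasurableSet {r : (ℝ × Z) × ℝ | 0 < r.2 ∧ r.2 < r.1.1} :=
      (measurableSet_lt measurable_const measurable_snd).inter
        (measurableSet_lt measurable_snd (by fun_prop))
    have hm : Measurable fun r : (ℝ × Z) × ℝ =>
        1 / h * Real.exp ((r.2 - r.1.1) / h) * γ r.2 r.1.2 := by
      have : Measurable fun r : (ℝ × Z) × ℝ => γ r.2 r.1.2 :=
        hγ.comp (f := fun r : (ℝ × Z) × ℝ => (r.2, r.1.2)) (by fun_prop)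
      fun_prop
    exact hm.indicator hs
  have h2 := h1.stronglyMeasurable.integral_prod_right' (ν := (volume : Measure ℝ))
  simp_rw [integral_indicator measurableSet_Ioo] at h2
  exact h2.measurable

/-- Jensen's inequality for the exponential mollification, integrated in space and time. -/
theorem lintegral_ofReal_expAverage_le {Z : Type*} [MeasurableSpace Z] {ν : Measure Z} [SFinite ν]
    {h T : ℝ} (hh : 0 < h) (hT : 0 ≤ T) {F : Z → ℝ → ℝ} (hF : Measurable (Function.uncurry F))
    (hFconv : ∀ z, ConvexOn ℝ univ (F z)) (hFcont : ∀ z, Continuous (F z))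
    (hF0 : ∀ z ξ, 0 ≤ F z ξ) {α : Z → ℝ} {γ : ℝ → Z → ℝ} (hα : Measurable α)
    (hγ : Measurable (Function.uncurry γ)) (hγi : ∀ z, IntegrableOn (fun s => γ s z) (Ioo 0 T)) :
    ∫⁻ t in Ioo 0 T, ∫⁻ z, ENNReal.ofReal (F z (expAverage h (α z) (fun s => γ s z) t)) ∂ν ≤
      ENNReal.ofReal h * ∫⁻ z, ENNReal.ofReal (F z (α z)) ∂ν +
        ∫⁻ t in Ioo 0 T, ∫⁻ z, ENNReal.ofReal (F z (γ t z)) ∂ν := by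
  have hA : Measurable fun z => ENNReal.ofReal (F z (α z)) :=
    (hF.comp (measurable_id.prodMk hα)).ennreal_ofReal
  have hB : Measurable fun q : ℝ × Z => ENNReal.ofReal (F q.2 (γ q.1 q.2)) :=
    (hF.comp (measurable_snd.prodMk hγ)).ennreal_ofReal
  -- Extending the kernel by zero to s ≥ t makes the domain of s independent of t, as the exchange
  -- of the two time integrals requires.
  set K : ℝ → ℝ → ℝ≥0∞ := fun t s =>
    (Ioi s).indicator (fun t => ENNReal.ofReal (1 / h * Real.exp ((s - t) / h))) t with hK
  have hKm : Measurable (Function.uncurry K) := by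
    have hm : Measurable fun q : ℝ × ℝ => ENNReal.ofReal (1 / h * Real.exp ((q.2 - q.1) / h)) := by
      fun_prop
    exact hm.indicator (measurableSet_lt measurable_snd measurable_fst)
  have hKm1 : ∀ t, Measurable (K t) := fun t => hKm.comp measurable_prodMk_left
  have hKB : ∀ t, Measurable fun q : ℝ × Z => K t q.1 * ENNReal.ofReal (F q.2 (γ q.1 q.2)) :=
    fun t => ((hKm1 t).comp measurable_fst).mul hB
  set EB : ℝ → ℝ≥0∞ := fun s => ∫⁻ z, ENNReal.ofReal (F z (γ s z)) ∂ν with hEB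
  have hEBm : Measurable EB := hB.lintegral_prod_right'
  have step1 : ∀ t ∈ Ioo 0 T, ∀ z,
      ENNReal.ofReal (F z (expAverage h (α z) (fun s => γ s z) t)) ≤
        ENNReal.ofReal (Real.exp (-t / h)) * ENNReal.ofReal (F z (α z)) +
          ∫⁻ s in Ioo 0 T, K t s * ENNReal.ofReal (F z (γ s z)) := by
    intro t ht z
    refine (ofReal_expAverage_le hh ht.1.le (hFconv z) (hFcont z) (hF0 z)
      (hγ.comp measurable_prodMk_right)
      ((hγi z).mono_set (Ioo_subset_Ioo_right ht.2.le))).trans ?_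
    refine add_le_add le_rfl ?_
    calc ∫⁻ s in Ioo 0 t, ENNReal.ofReal (1 / h * Real.exp ((s - t) / h)) *
          ENNReal.ofReal (F z (γ s z))
        = ∫⁻ s in Ioo 0 t, K t s * ENNReal.ofReal (F z (γ s z)) :=
          setLIntegral_congr_fun measurableSet_Ioo fun s hs => by
            simp only [hK]; rw [indicator_of_mem (show t ∈ Ioi s from hs.2)]
      _ ≤ _ := lintegral_mono_set (Ioo_subset_Ioo_right ht.2.le)
  have step2 : ∀ t ∈ Ioo 0 T,
      ∫⁻ z, ENNReal.ofReal (F z (expAverage h (α z) (fun s => γ s z) t)) ∂ν ≤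
        ENNReal.ofReal (Real.exp (-t / h)) * ∫⁻ z, ENNReal.ofReal (F z (α z)) ∂ν +
          ∫⁻ s in Ioo 0 T, K t s * EB s := by
    intro t ht
    refine (lintegral_mono (step1 t ht)).trans (le_of_eq ?_)
    rw [lintegral_add_left (hA.const_mul _), lintegral_const_mul _ hA]
    congr 1
    rw [lintegral_lintegral_swap]
    · congr 1; ext s
      rw [lintegral_const_mul]
      exact hB.comp measurable_prodMk_left
    · exact ((hKB t).comp measurable_swap).aemeasurable
  refine (setLIntegral_mono' measurableSet_Ioo step2).trans ?_
  rw [lintegral_add_left (by fun_prop), lintegral_mul_const _ (by fun_prop)]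
  refine add_le_add (mul_le_mul_left (lintegral_exp_neg_le hh hT) _) ?_
  rw [lintegral_lintegral_swap]
  · refine setLIntegral_mono' measurableSet_Ioo fun s hs => ?_
    have hKs : Measurable fun t => K t s := hKm.comp measurable_prodMk_right
    rw [lintegral_mul_const _ hKs]
    refine mul_le_of_le_one_left' ?_
    simp only [hK]
    rw [lintegral_indicator measurableSet_Ioi, Measure.restrict_restrict measurableSet_Ioi]
    refine le_trans (lintegral_mono_set ?_) (lintegral_exp_kernel_le hh hs.2.le)
    exact fun t ht => ⟨ht.1, ht.2.2⟩
  · exact (hKm.mul (hEBm.comp measurable_snd)).aemeasurable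

/-! ### Removing null sets from the density, and invariance under a.e. equality -/

/-- A representative of the density `H(x, y, ξ) / |x - y|^N` that is jointly measurable, convex and
continuous in `ξ`, without exceptional sets. -/
theorem exists_measurable_density {N : ℕ} {s p A : ℝ} (hA : 0 ≤ A)
    {H : Space N → Space N → ℝ → ℝ} (hH : StructureCondition s p A H) :
    ∃ F : Space N × Space N → ℝ → ℝ, Measurable (Function.uncurry F) ∧
      (∀ z, ConvexOn ℝ univ (F z)) ∧ (∀ z, Continuous (F z)) ∧ (∀ z ξ, 0 ≤ F z ξ) ∧
      ∀ᵐ z : Space N × Space N, ∀ ξ, H z.1 z.2 ξ / ‖z.1 - z.2‖ ^ N = F z ξ := by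
  -- Measurability is given for each ξ up to a null set depending on ξ. One null set serves all
  -- rational ξ, and continuity then reaches every real ξ.
  let P : Space N × Space N → Prop := fun z => Continuous (H z.1 z.2) ∧
    ConvexOn ℝ univ (H z.1 z.2) ∧ (∀ ξ, 0 ≤ H z.1 z.2 ξ) ∧
    ∀ q : ℚ, H z.1 z.2 q = (hH.aemeasurable q).mk _ z
  have hP : ∀ᵐ z, P z := by
    filter_upwards [hH.continuous, hH.convexOn, hH.lower_bound,
      ae_all_iff.2 fun q : ℚ => (hH.aemeasurable q).ae_eq_mk] with z h1 h2 h3 h4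
    exact ⟨h1, h2, fun ξ => le_trans (by positivity) (h3 ξ), h4⟩
  obtain ⟨S, hSP, hSm, hS⟩ := hP.exists_measurable_mem
  classical
  let F : Space N × Space N → ℝ → ℝ := fun z ξ =>
    if z ∈ S then H z.1 z.2 ξ / ‖z.1 - z.2‖ ^ N else 0
  have hFc : ∀ z, Continuous (F z) := fun z => by
    by_cases hz : z ∈ S
    · simp only [F, hz, if_true]; exact (hS z hz).1.div_const _
    · simp only [F, hz, if_false]; exact continuous_const
  have hFq : ∀ q : ℚ, Measurable fun z => F z q := fun q => by
    have : (fun z => F z q) = fun z => if z ∈ S then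
        (hH.aemeasurable q).mk _ z / ‖z.1 - z.2‖ ^ N else 0 := by
      ext z
      by_cases hz : z ∈ S
      · simp only [F, hz, if_true]; rw [(hS z hz).2.2.2 q]
      · simp only [F, hz, if_false]
    rw [this]
    refine Measurable.ite hSm ?_ measurable_const
    exact (hH.aemeasurable q).measurable_mk.div (by fun_prop)
  have hFm : ∀ ξ, Measurable fun z => F z ξ := fun ξ => by
    obtain ⟨q, hq⟩ : ∃ q : ℕ → ℚ, Tendsto (fun n => (q n : ℝ)) atTop (𝓝 ξ) := by
      have := Rat.isDenseEmbedding_coe_real.dense ξ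
      obtain ⟨x, hx, hxt⟩ := mem_closure_iff_seq_limit.1 this
      choose q hq using hx
      exact ⟨q, by simpa [hq] using hxt⟩
    refine measurable_of_tendsto_metrizable (fun n => hFq (q n)) ?_
    exact tendsto_pi_nhds.2 fun z => ((hFc z).tendsto ξ).comp hq
  refine ⟨F, ?_, fun z => ?_, hFc, fun z ξ => ?_, ?_⟩
  · have := measurable_uncurry_of_continuous_of_measurable (u := fun ξ z => F z ξ)
      (fun z => hFc z) hFm
    exact this.comp measurable_swap
  · by_cases hz : z ∈ S
    · have : F z = fun ξ => (‖z.1 - z.2‖ ^ N)⁻¹ • H z.1 z.2 ξ := by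
        ext ξ; simp only [F, hz, if_true, smul_eq_mul]; rw [div_eq_inv_mul]
      rw [this]
      exact (hS z hz).2.1.smul (by positivity)
    · have : F z = fun _ => 0 := by ext ξ; simp only [F, hz, if_false]
      rw [this]
      exact convexOn_const _ convex_univ
  · by_cases hz : z ∈ S
    · simp only [F, hz, if_true]; exact div_nonneg ((hS z hz).2.2.1 ξ) (by positivity)
    · simp only [F, hz, if_false]; exact le_rfl
  · filter_upwards [hSP] with z hz ξ
    simp only [F, hz, if_true]

theorem ae_prod_eq_of_ae_eq {N : ℕ} {ψ χ : Space N → ℝ} (h : ψ =ᵐ[volume] χ) :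
    ∀ᵐ z : Space N × Space N, ψ z.1 = χ z.1 ∧ ψ z.2 = χ z.2 := by
  have h1 := (Measure.quasiMeasurePreserving_fst (μ := (volume : Measure (Space N)))
    (ν := (volume : Measure (Space N)))).ae h
  have h2 := (Measure.quasiMeasurePreserving_snd (μ := (volume : Measure (Space N)))
    (ν := (volume : Measure (Space N)))).ae h
  exact h1.and h2

theorem energy_congr {N : ℕ} (H : Space N → Space N → ℝ → ℝ) {ψ χ : Space N → ℝ}
    (h : ψ =ᵐ[volume] χ) : energy H ψ = energy H χ := by
  refine lintegral_congr_ae ?_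
  filter_upwards [ae_prod_eq_of_ae_eq h] with z hz
  rw [hz.1, hz.2]

theorem gagliardoPow_congr {N : ℕ} (s p : ℝ) {ψ χ : Space N → ℝ}
    (h : ψ =ᵐ[volume] χ) : gagliardoPow s p ψ = gagliardoPow s p χ := by
  refine lintegral_congr_ae ?_
  filter_upwards [ae_prod_eq_of_ae_eq h] with z hz
  rw [hz.1, hz.2]

theorem sobolevNorm_congr {N : ℕ} (s p : ℝ) {ψ χ : Space N → ℝ}
    (h : ψ =ᵐ[volume] χ) : sobolevNorm s p ψ = sobolevNorm s p χ := by
  rw [sobolevNorm, sobolevNorm, eLpNorm_congr_ae h, gagliardoPow_congr s p h]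

theorem MemSobolev.congr {N : ℕ} {s p : ℝ} {ψ χ : Space N → ℝ} (hψ : MemSobolev s p ψ)
    (h : ψ =ᵐ[volume] χ) : MemSobolev s p χ :=
  ⟨hψ.1.ae_eq h, gagliardoPow_congr s p h ▸ hψ.2⟩

theorem MemLpSobolev.congr {N : ℕ} {s p T : ℝ} {u v : ℝ → Space N → ℝ}
    (hu : MemLpSobolev s p T u)
    (hv : AEStronglyMeasurable (Function.uncurry v) (cylinderMeasure univ T))
    (h : ∀ t, u t =ᵐ[volume] v t) : MemLpSobolev s p T v := by
  refine ⟨hv, ?_, ?_⟩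
  · filter_upwards [hu.mem_sobolev] with t ht htT
    exact (ht htT).congr (h t)
  · simp_rw [← sobolevNorm_congr s p (h _)]
    exact hu.lintegral_lt_top

/-! ### Coercivity and integral bounds in the fractional Sobolev space -/

/-- The lower bound on `H` controls the Gagliardo seminorm by the energy. -/
theorem gagliardoPow_le_energy {N : ℕ} {s p A : ℝ} (hp : 0 < p) (hA : 0 < A)
    {H : Space N → Space N → ℝ → ℝ} (hH : StructureCondition s p A H) (ψ : Space N → ℝ) :
    gagliardoPow s p ψ ≤ ENNReal.ofReal (1 / A) * energy H ψ := by
  rw [gagliardoPow, energy, ← lintegral_const_mul' _ _ ENNReal.ofReal_ne_top]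
  refine lintegral_mono_ae ?_
  filter_upwards [hH.lower_bound] with z hz
  rw [← ENNReal.ofReal_mul (by positivity)]
  refine ENNReal.ofReal_le_ofReal ?_
  -- On the diagonal the difference of ψ vanishes, so the left side is 0. Off it, dividing the lower
  -- bound by |x - y|^N gives exactly the exponent N + s p.
  by_cases h0 : z.1 - z.2 = 0
  · have hψ : ψ z.1 - ψ z.2 = 0 := by rw [sub_eq_zero.1 h0, sub_self]
    rw [hψ, abs_zero, Real.zero_rpow hp.ne', zero_div]
    have h1 := hz 0
    have h2 : 0 ≤ H z.1 z.2 0 := le_trans (by positivity) h1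
    positivity
  · have hr : 0 < ‖z.1 - z.2‖ := norm_pos_iff.2 h0
    have h1 := hz (ψ z.1 - ψ z.2)
    rw [Real.div_rpow (abs_nonneg _) (by positivity), ← Real.rpow_mul hr.le] at h1
    rw [Real.rpow_add hr, Real.rpow_natCast, div_mul_eq_div_div_swap, ← mul_div_assoc]
    refine div_le_div_of_nonneg_right ?_ (by positivity)
    rw [one_div, ← div_eq_inv_mul, le_div_iff₀' hA]
    exact h1

theorem abs_sub_rpow_le {p : ℝ} (hp : 1 ≤ p) (a b : ℝ) :
    |a - b| ^ p ≤ 2 ^ (p - 1) * (|a| ^ p + |b| ^ p) := by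
  refine (Real.rpow_le_rpow (abs_nonneg _) (abs_sub a b) (by linarith)).trans ?_
  have := NNReal.rpow_add_le_mul_rpow_add_rpow ‖a‖₊ ‖b‖₊ hp
  exact_mod_cast this

theorem measurable_gagliardo_integrand {N : ℕ} (s p : ℝ) {v : ℝ → Space N → ℝ}
    (hv : Measurable (Function.uncurry v)) :
    Measurable fun q : ℝ × (Space N × Space N) =>
      ENNReal.ofReal (|v q.1 q.2.1 - v q.1 q.2.2| ^ p / ‖q.2.1 - q.2.2‖ ^ ((N : ℝ) + s * p)) := by
  have h1 : Measurable fun q : ℝ × (Space N × Space N) => v q.1 q.2.1 :=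
    hv.comp (f := fun q : ℝ × (Space N × Space N) => (q.1, q.2.1)) (by fun_prop)
  have h2 : Measurable fun q : ℝ × (Space N × Space N) => v q.1 q.2.2 :=
    hv.comp (f := fun q : ℝ × (Space N × Space N) => (q.1, q.2.2)) (by fun_prop)
  fun_prop

theorem measurable_gagliardoPow {N : ℕ} (s p : ℝ) {v : ℝ → Space N → ℝ}
    (hv : Measurable (Function.uncurry v)) : Measurable fun t => gagliardoPow s p (v t) :=
  (measurable_gagliardo_integrand s p hv).lintegral_prod_right'

theorem gagliardoPow_sub_le {N : ℕ} {s p : ℝ} (hp : 1 ≤ p) {ψ χ : Space N → ℝ}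
    (hψ : Measurable ψ) : gagliardoPow s p (fun x => ψ x - χ x) ≤
      ENNReal.ofReal (2 ^ (p - 1)) * (gagliardoPow s p ψ + gagliardoPow s p χ) := by
  have hm : Measurable fun z : Space N × Space N =>
      ENNReal.ofReal (|ψ z.1 - ψ z.2| ^ p / ‖z.1 - z.2‖ ^ ((N : ℝ) + s * p)) := by
    have h1 : Measurable fun z : Space N × Space N => ψ z.1 := hψ.comp measurable_fst
    have h2 : Measurable fun z : Space N × Space N => ψ z.2 := hψ.comp measurable_snd
    fun_prop
  simp only [gagliardoPow]
  rw [← lintegral_add_left hm, ← lintegral_const_mul' _ _ ENNReal.ofReal_ne_top]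
  refine lintegral_mono fun z => ?_
  simp only
  rw [← ENNReal.ofReal_add (by positivity) (by positivity), ← ENNReal.ofReal_mul (by positivity)]
  refine ENNReal.ofReal_le_ofReal ?_
  rw [← add_div, ← mul_div_assoc]
  refine div_le_div_of_nonneg_right ?_ (by positivity)
  rw [show ψ z.1 - χ z.1 - (ψ z.2 - χ z.2) = (ψ z.1 - ψ z.2) - (χ z.1 - χ z.2) by ring]
  exact abs_sub_rpow_le hp _ _

theorem eLpNorm_ofReal_rpow {X : Type*} [MeasurableSpace X] {μ : Measure X} {p : ℝ} (hp : 0 < p)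
    (ψ : X → ℝ) :
    eLpNorm ψ (ENNReal.ofReal p) μ ^ p = ∫⁻ x, ENNReal.ofReal (|ψ x| ^ p) ∂μ := by
  rw [eLpNorm_eq_lintegral_rpow_enorm_toReal (by simpa using hp) ENNReal.ofReal_ne_top,
    ENNReal.toReal_ofReal hp.le, ← ENNReal.rpow_mul, one_div, inv_mul_cancel₀ hp.ne',
    ENNReal.rpow_one]
  congr 1; ext x
  rw [← ENNReal.ofReal_rpow_of_nonneg (abs_nonneg _) hp.le, Real.enorm_eq_ofReal_abs]

theorem sobolevNorm_rpow_le {N : ℕ} {s p : ℝ} (hp : 1 ≤ p) (ψ : Space N → ℝ) :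
    sobolevNorm s p ψ ^ p ≤
      2 ^ (p - 1) * ((∫⁻ x, ENNReal.ofReal (|ψ x| ^ p)) + gagliardoPow s p ψ) := by
  have hp0 : 0 < p := by linarith
  refine (ENNReal.rpow_add_le_mul_rpow_add_rpow _ _ hp).trans (le_of_eq ?_)
  rw [eLpNorm_ofReal_rpow hp0, ← ENNReal.rpow_mul, one_div, inv_mul_cancel₀ hp0.ne',
    ENNReal.rpow_one]

theorem measurable_lintegral_abs_rpow {X : Type*} [MeasurableSpace X] (μ : Measure X) [SFinite μ]
    (p : ℝ) {v : ℝ → X → ℝ} (hv : Measurable (Function.uncurry v)) :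
    Measurable fun t => ∫⁻ x, ENNReal.ofReal (|v t x| ^ p) ∂μ := by
  have h : Measurable fun q : ℝ × X => ENNReal.ofReal (|v q.1 q.2| ^ p) :=
    (hv.abs.pow_const p).ennreal_ofReal
  exact h.lintegral_prod_right'

theorem memLpSobolev_of_lintegral_lt_top {N : ℕ} {s p T : ℝ} (hp : 1 ≤ p) {v : ℝ → Space N → ℝ}
    (hv : Measurable (Function.uncurry v))
    (hvp : ∫⁻ t in Ioo 0 T, ∫⁻ x, ENNReal.ofReal (|v t x| ^ p) < ⊤)
    (hvg : ∫⁻ t in Ioo 0 T, gagliardoPow s p (v t) < ⊤) : MemLpSobolev s p T v := by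
  have hp0 : 0 < p := by linarith
  refine ⟨hv.aestronglyMeasurable, ?_, ?_⟩
  · have h1 := (ae_restrict_iff' measurableSet_Ioo).1
      (ae_lt_top (measurable_lintegral_abs_rpow volume p hv) hvp.ne)
    have h2 := (ae_restrict_iff' measurableSet_Ioo).1
      (ae_lt_top (measurable_gagliardoPow s p hv) hvg.ne)
    filter_upwards [h1, h2] with t ht1 ht2 htT
    refine ⟨⟨(hv.comp measurable_prodMk_left).aestronglyMeasurable, ?_⟩, ht2 htT⟩
    have := ht1 htT
    rw [← eLpNorm_ofReal_rpow hp0] at this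
    exact (ENNReal.rpow_lt_top_iff_of_pos hp0).1 this
  · refine (lintegral_mono fun t => sobolevNorm_rpow_le hp (v t)).trans_lt ?_
    have h2 : (2 : ℝ≥0∞) ^ (p - 1) ≠ ⊤ :=
      ENNReal.rpow_ne_top_of_nonneg (by linarith) (by simp)
    rw [lintegral_const_mul' _ _ h2,
      lintegral_add_left (measurable_lintegral_abs_rpow volume p hv)]
    exact ENNReal.mul_lt_top h2.lt_top (ENNReal.add_lt_top.2 ⟨hvp, hvg⟩)

theorem MemLpSobolev.lintegral_abs_rpow_lt_top {N : ℕ} {s p T : ℝ} (hp : 0 < p)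
    {u : ℝ → Space N → ℝ} (hu : MemLpSobolev s p T u) :
    ∫⁻ t in Ioo 0 T, ∫⁻ x, ENNReal.ofReal (|u t x| ^ p) < ⊤ := by
  refine lt_of_le_of_lt (lintegral_mono fun t => ?_) hu.lintegral_lt_top
  rw [← eLpNorm_ofReal_rpow hp]
  exact ENNReal.rpow_le_rpow le_self_add hp.le

/-- Subtracting a fixed Sobolev function from a map that satisfies the integral bounds. -/
theorem memLpSobolev_sub {N : ℕ} {s p T : ℝ} (hp : 1 ≤ p) {v : ℝ → Space N → ℝ}
    {b : Space N → ℝ} (hb : MemSobolev s p b) (hv : Measurable (Function.uncurry v))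
    (hvp : ∫⁻ t in Ioo 0 T, ∫⁻ x, ENNReal.ofReal (|v t x| ^ p) < ⊤)
    (hvg : ∫⁻ t in Ioo 0 T, gagliardoPow s p (v t) < ⊤) :
    MemLpSobolev s p T (fun t x => v t x - b x) := by
  have hp0 : 0 < p := by linarith
  set b' := hb.1.aestronglyMeasurable.mk b with hb'
  have hbb : b =ᵐ[volume] b' := hb.1.aestronglyMeasurable.ae_eq_mk
  have hb'm : Measurable b' := hb.1.aestronglyMeasurable.stronglyMeasurable_mk.measurable
  have hb'S := hb.congr hbb
  have hvb : Measurable (Function.uncurry fun t x => v t x - b' x) :=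
    hv.sub (hb'm.comp measurable_snd)
  have key : MemLpSobolev s p T (fun t x => v t x - b' x) := by
    refine memLpSobolev_of_lintegral_lt_top hp hvb ?_ ?_
    · have h1 : ∀ t, ∫⁻ x, ENNReal.ofReal (|v t x - b' x| ^ p) ≤ ENNReal.ofReal (2 ^ (p - 1)) *
          ((∫⁻ x, ENNReal.ofReal (|v t x| ^ p)) + ∫⁻ x, ENNReal.ofReal (|b' x| ^ p)) := by
        intro t
        have hvt : Measurable fun x => v t x := hv.comp measurable_prodMk_left
        rw [← lintegral_add_left (by fun_prop),
          ← lintegral_const_mul' _ _ ENNReal.ofReal_ne_top]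
        refine lintegral_mono fun x => ?_
        simp only
        rw [← ENNReal.ofReal_add (by positivity) (by positivity),
          ← ENNReal.ofReal_mul (by positivity)]
        exact ENNReal.ofReal_le_ofReal (abs_sub_rpow_le hp _ _)
      refine (lintegral_mono h1).trans_lt ?_
      rw [lintegral_const_mul' _ _ ENNReal.ofReal_ne_top,
        lintegral_add_left (measurable_lintegral_abs_rpow volume p hv)]
      refine ENNReal.mul_lt_top (by simp) (ENNReal.add_lt_top.2 ⟨hvp, ?_⟩)
      rw [lintegral_const, ← eLpNorm_ofReal_rpow hp0]
      exact ENNReal.mul_lt_top (ENNReal.rpow_lt_top_of_nonneg hp0.le hb'S.1.2.ne) (by simp)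
    · refine (lintegral_mono fun t => gagliardoPow_sub_le hp
        (hv.comp measurable_prodMk_left)).trans_lt ?_
      rw [lintegral_const_mul' _ _ ENNReal.ofReal_ne_top, lintegral_add_right _ measurable_const]
      refine ENNReal.mul_lt_top (by simp) (ENNReal.add_lt_top.2 ⟨hvg, ?_⟩)
      rw [lintegral_const]
      exact ENNReal.mul_lt_top hb'S.2 (by simp)
  refine key.congr ?_ fun t => ?_
  · refine hv.aestronglyMeasurable.sub ?_
    exact hb.1.aestronglyMeasurable.comp_quasiMeasurePreserving
      (by rw [cylinderMeasure, Measure.restrict_univ]; exact Measure.quasiMeasurePreserving_snd)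
  · filter_upwards [hbb] with x hx
    rw [hx]

/-! ### Square integrability on the cylinder -/

theorem eLpNorm_two_sq {X : Type*} [MeasurableSpace X] {μ : Measure X} (ψ : X → ℝ) :
    eLpNorm ψ 2 μ ^ 2 = ∫⁻ x, ENNReal.ofReal (ψ x ^ 2) ∂μ := by
  have := eLpNorm_ofReal_rpow (μ := μ) (p := 2) two_pos ψ
  simpa using this

theorem memLp_two_iff_lintegral {X : Type*} [MeasurableSpace X] {μ : Measure X} {ψ : X → ℝ}
    (hψ : AEStronglyMeasurable ψ μ) :
    MemLp ψ 2 μ ↔ ∫⁻ x, ENNReal.ofReal (ψ x ^ 2) ∂μ < ⊤ := by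
  rw [← eLpNorm_two_sq, ENNReal.pow_lt_top_iff]
  simp [MemLp, hψ]

theorem lintegral_cylinderMeasure {N : ℕ} {Ω : Set (Space N)} {T : ℝ}
    {f : ℝ × Space N → ℝ≥0∞} (hf : AEMeasurable f (cylinderMeasure Ω T)) :
    ∫⁻ z, f z ∂(cylinderMeasure Ω T) = ∫⁻ t in Ioo 0 T, ∫⁻ x in Ω, f (t, x) :=
  lintegral_prod _ hf

theorem memLp_cylinderMeasure_iff {N : ℕ} {Ω : Set (Space N)} {T : ℝ} {v : ℝ → Space N → ℝ}
    (hv : AEStronglyMeasurable (Function.uncurry v) (cylinderMeasure Ω T)) :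
    MemLp (Function.uncurry v) 2 (cylinderMeasure Ω T) ↔
      ∫⁻ t in Ioo 0 T, ∫⁻ x in Ω, ENNReal.ofReal (v t x ^ 2) < ⊤ := by
  rw [memLp_two_iff_lintegral hv,
    lintegral_cylinderMeasure (hv.aemeasurable.pow_const 2).ennreal_ofReal]
  rfl

/-! ### Test functions -/

theorem IsTestFunction.apply_eq_zero {N : ℕ} {Ω : Set (Space N)} {T : ℝ} {φ : ℝ → Space N → ℝ}
    (hφ : IsTestFunction Ω T φ) {t : ℝ} {x : Space N} (h : (t, x) ∉ Ioo 0 T ×ˢ Ω) :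
    φ t x = 0 :=
  image_eq_zero_of_notMem_tsupport (f := Function.uncurry φ) fun hm => h (hφ.tsupport_subset hm)

theorem IsTestFunction.contDiff_slice {N : ℕ} {Ω : Set (Space N)} {T : ℝ}
    {φ : ℝ → Space N → ℝ} (hφ : IsTestFunction Ω T φ) (x : Space N) :
    ContDiff ℝ ∞ fun t => φ t x :=
  hφ.contDiff.comp (f := fun t : ℝ => (t, x)) (by fun_prop)

theorem IsTestFunction.timeDeriv_eq_fderiv {N : ℕ} {Ω : Set (Space N)} {T : ℝ}
    {φ : ℝ → Space N → ℝ} (hφ : IsTestFunction Ω T φ) (t : ℝ) (x : Space N) :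
    timeDeriv φ t x = fderiv ℝ (Function.uncurry φ) (t, x) (1, 0) := by
  have h1 : HasFDerivAt (Function.uncurry φ) (fderiv ℝ (Function.uncurry φ) (t, x)) (t, x) :=
    (hφ.contDiff.differentiable (by simp)).differentiableAt.hasFDerivAt
  have h2 : HasDerivAt (fun τ : ℝ => (τ, x)) ((1 : ℝ), (0 : Space N)) t :=
    (hasDerivAt_id t).prodMk (hasDerivAt_const t x)
  exact (h1.comp_hasDerivAt t h2).deriv

theorem IsTestFunction.isTestFunction_timeDeriv {N : ℕ} {Ω : Set (Space N)} {T : ℝ}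
    {φ : ℝ → Space N → ℝ}
    (hφ : IsTestFunction Ω T φ) : IsTestFunction Ω T (timeDeriv φ) := by
  have hEq : Function.uncurry (timeDeriv φ) =
      fun z => fderiv ℝ (Function.uncurry φ) z (1, 0) := by
    ext ⟨t, x⟩
    exact hφ.timeDeriv_eq_fderiv t x
  refine ⟨?_, ?_, ?_⟩
  · rw [hEq]
    exact (hφ.contDiff.fderiv_right (m := ∞) (by simp)).clm_apply contDiff_const
  · rw [hEq]
    exact hφ.hasCompactSupport.fderiv_apply ℝ (1, 0)
  · rw [hEq]
    exact (tsupport_fderiv_apply_subset ℝ (1, 0)).trans hφ.tsupport_subset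

theorem IsTestFunction.memLp {N : ℕ} {Ω Ω' : Set (Space N)} {T : ℝ} {φ : ℝ → Space N → ℝ}
    (hφ : IsTestFunction Ω T φ) (q : ℝ≥0∞) :
    MemLp (Function.uncurry φ) q (cylinderMeasure Ω' T) := by
  have : IsFiniteMeasureOnCompacts (cylinderMeasure Ω' T) := by
    unfold cylinderMeasure; infer_instance
  exact hφ.contDiff.continuous.memLp_of_hasCompactSupport hφ.hasCompactSupport

/-! ### Maps that are primitives in time -/

theorem integral_cylinderMeasure_eq {N : ℕ} {Ω : Set (Space N)} {T : ℝ} (hT : 0 ≤ T)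
    {f : ℝ × Space N → ℝ} (hf : Integrable f (cylinderMeasure Ω T)) :
    ∫ z, f z ∂(cylinderMeasure Ω T) = ∫ x in Ω, ∫ t in 0..T, f (t, x) := by
  rw [cylinderMeasure, integral_prod_symm _ hf]
  congr 1; ext x
  rw [intervalIntegral.integral_of_le hT, integral_Ioc_eq_integral_Ioo]

/-- By Fubini the identity reduces to integration by parts in t for each fixed x. The boundary terms
vanish because φ is zero at times 0 and T. -/
theorem hasWeakTimeDerivL2_of_primitive {N : ℕ} {Ω : Set (Space N)} {T : ℝ} (hT : 0 ≤ T)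
    {a : Space N → ℝ} {v w : ℝ → Space N → ℝ}
    (hv : MemLp (Function.uncurry v) 2 (cylinderMeasure Ω T))
    (hw : MemLp (Function.uncurry w) 2 (cylinderMeasure Ω T))
    (hwi : ∀ x, IntervalIntegrable (fun t => w t x) volume 0 T)
    (hvw : ∀ x, ∀ t ∈ Icc 0 T, v t x = a x + ∫ s in 0..t, w s x) :
    HasWeakTimeDerivL2 Ω T v w := by
  refine ⟨hw, fun φ hφ => ?_⟩
  have h1 := hv.integrable_mul (hφ.isTestFunction_timeDeriv.memLp 2)
  have h2 := hw.integrable_mul (hφ.memLp 2)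
  rw [integral_cylinderMeasure_eq hT (f := fun z => v z.1 z.2 * timeDeriv φ z.1 z.2) h1,
    integral_cylinderMeasure_eq hT (f := fun z => w z.1 z.2 * φ z.1 z.2) h2, ← integral_neg]
  congr 1; ext x
  have key := integral_primitive_mul_deriv (a := a x) (hwi x)
    ((hφ.contDiff_slice x).of_le (by simp))
  have h0 : φ 0 x = 0 := hφ.apply_eq_zero fun h => lt_irrefl _ h.1.1
  have hTx : φ T x = 0 := hφ.apply_eq_zero fun h => lt_irrefl _ h.1.2
  rw [h0, hTx, mul_zero, mul_zero, sub_zero, zero_sub] at key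
  rw [← key]
  apply intervalIntegral.integral_congr
  intro t ht
  rw [uIcc_of_le hT] at ht
  simp only [hvw x t ht, timeDeriv]

/-- Cauchy-Schwarz in time; integrated over Ω it yields Hölder continuity of order 1/2 in L². -/
theorem ofReal_sq_intervalIntegral_le {T : ℝ} {w : ℝ → ℝ} (hw : Measurable w) {t τ : ℝ}
    (ht : t ∈ Icc 0 T) (hτ : τ ∈ Icc 0 T) :
    ENNReal.ofReal ((∫ s in t..τ, w s) ^ 2) ≤
      ENNReal.ofReal |τ - t| * ∫⁻ s in Ioo 0 T, ENNReal.ofReal (w s ^ 2) := by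
  set μ := (volume : Measure ℝ).restrict (uIoc t τ) with hμ
  have h1 : ‖∫ s in t..τ, w s‖ₑ ≤ ∫⁻ s, ‖w s‖ₑ ∂μ := by
    rw [← ofReal_norm, intervalIntegral.norm_intervalIntegral_eq, ofReal_norm]
    exact enorm_integral_le_lintegral_enorm _
  have h2 : (∫⁻ s, ‖w s‖ₑ ∂μ) ^ 2 ≤ (∫⁻ s, ENNReal.ofReal (w s ^ 2) ∂μ) * μ univ := by
    have h3 := eLpNorm_le_eLpNorm_mul_rpow_measure_univ (μ := μ) (p := 1) (q := 2)
      (by norm_num) hw.aestronglyMeasurable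
    rw [eLpNorm_one_eq_lintegral_enorm] at h3
    refine (pow_le_pow_left' h3 2).trans (le_of_eq ?_)
    rw [mul_pow, eLpNorm_two_sq]
    congr 1
    rw [← ENNReal.rpow_natCast, ← ENNReal.rpow_mul]
    norm_num
  have h4 : ENNReal.ofReal ((∫ s in t..τ, w s) ^ 2) = ‖∫ s in t..τ, w s‖ₑ ^ 2 := by
    rw [Real.enorm_eq_ofReal_abs, ← ENNReal.ofReal_pow (abs_nonneg _), sq_abs]
  rw [h4]
  refine (pow_le_pow_left' h1 2).trans (h2.trans ?_)
  have h5 : μ univ = ENNReal.ofReal |τ - t| := by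
    rw [hμ, Measure.restrict_apply_univ, uIoc, Real.volume_Ioc, max_sub_min_eq_abs]
  rw [h5, mul_comm]
  refine mul_le_mul_right ?_ _
  rw [setLIntegral_congr (Ioo_ae_eq_Ioc (a := (0 : ℝ)) (b := T))]
  exact lintegral_mono_set (Ioc_subset_Ioc (le_min ht.1 hτ.1) (max_le ht.2 hτ.2))

theorem continuousInL2_of_primitive {N : ℕ} {Ω : Set (Space N)} {T : ℝ} (hT : 0 ≤ T)
    {a : Space N → ℝ} {v w : ℝ → Space N → ℝ} (ha : MemLp a 2 (volume.restrict Ω))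
    (hv : ∀ t, Measurable (v t)) (hwm : Measurable (Function.uncurry w))
    (hw : MemLp (Function.uncurry w) 2 (cylinderMeasure Ω T))
    (hwi : ∀ x, IntervalIntegrable (fun t => w t x) volume 0 T)
    (hvw : ∀ x, ∀ t ∈ Icc 0 T, v t x = a x + ∫ s in 0..t, w s x) :
    ContinuousInL2 Ω T v := by
  set W := ∫⁻ x in Ω, ∫⁻ t in Ioo 0 T, ENNReal.ofReal (w t x ^ 2) with hW
  have hWtop : W < ⊤ := by
    have := (memLp_cylinderMeasure_iff hw.1).1 hw
    rwa [lintegral_lintegral_swap (hwm.pow_const 2).ennreal_ofReal.aemeasurable] at this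
  have hsub : ∀ t ∈ Icc 0 T, ∀ τ ∈ Icc 0 T, ∀ x, v τ x - v t x = ∫ s in t..τ, w s x := by
    intro t ht τ hτ x
    rw [hvw x t ht, hvw x τ hτ, add_sub_add_left_eq_sub]
    have hsubset : ∀ r ∈ Icc 0 T, IntervalIntegrable (fun t => w t x) volume 0 r := fun r hr =>
      (hwi x).mono_set (by
        rw [uIcc_of_le hr.1, uIcc_of_le hT]; exact Icc_subset_Icc_right hr.2)
    exact intervalIntegral.integral_interval_sub_left (hsubset τ hτ) (hsubset t ht)
  have hbound : ∀ t ∈ Icc 0 T, ∀ τ ∈ Icc 0 T,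
      eLpNorm (v τ - v t) 2 (volume.restrict Ω) ^ 2 ≤ ENNReal.ofReal |τ - t| * W := by
    intro t ht τ hτ
    rw [eLpNorm_two_sq, hW, ← lintegral_const_mul' _ _ ENNReal.ofReal_ne_top]
    refine lintegral_mono fun x => ?_
    simp only [Pi.sub_apply]
    rw [hsub t ht τ hτ x]
    exact ofReal_sq_intervalIntegral_le (hwm.comp measurable_prodMk_right) ht hτ
  refine ⟨fun t ht => ?_, fun t ht => ?_⟩
  · have h0 : (0 : ℝ) ∈ Icc 0 T := left_mem_Icc.2 hT
    have hv0 : v 0 = a := by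
      ext x; rw [hvw x 0 h0, intervalIntegral.integral_same, add_zero]
    have hd : MemLp (v t - v 0) 2 (volume.restrict Ω) := by
      refine ⟨((hv t).sub (hv 0)).aestronglyMeasurable, ?_⟩
      have := (hbound 0 h0 t ht).trans_lt (ENNReal.mul_lt_top ENNReal.ofReal_lt_top hWtop)
      simpa using this
    have := hd.add (hv0.symm ▸ ha)
    simpa using this
  · have hlim : Tendsto (fun τ => (ENNReal.ofReal |τ - t| * W) ^ (1 / 2 : ℝ)) (𝓝[Icc 0 T] t)
        (𝓝 0) := by
      have h1 : Tendsto (fun τ => ENNReal.ofReal |τ - t|) (𝓝[Icc 0 T] t) (𝓝 0) := by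
        have : Tendsto (fun τ : ℝ => ENNReal.ofReal |τ - t|) (𝓝 t) (𝓝 (ENNReal.ofReal |t - t|)) :=
          (ENNReal.continuous_ofReal.comp (by fun_prop)).tendsto t
        simp only [sub_self, abs_zero, ENNReal.ofReal_zero] at this
        exact this.mono_left nhdsWithin_le_nhds
      have h2 := ENNReal.Tendsto.mul_const (b := W) h1 (Or.inr hWtop.ne)
      rw [zero_mul] at h2
      have h3 := (ENNReal.continuous_rpow_const (y := (1 / 2 : ℝ))).tendsto 0
      rw [ENNReal.zero_rpow_of_pos (by norm_num)] at h3
      exact h3.comp h2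
    refine tendsto_of_tendsto_of_tendsto_of_le_of_le' tendsto_const_nhds hlim
      (Eventually.of_forall fun _ => zero_le) ?_
    filter_upwards [self_mem_nhdsWithin] with τ hτ
    have := ENNReal.rpow_le_rpow (hbound t ht τ hτ) (by norm_num : (0 : ℝ) ≤ 1 / 2)
    rwa [← ENNReal.rpow_natCast, ← ENNReal.rpow_mul, show ((2 : ℕ) : ℝ) * (1 / 2) = 1 by norm_num,
      ENNReal.rpow_one] at this

/-- Continuity bounds the L² norm near each time, and compactness of [0,T] makes the bound uniform.
This makes the pairing of `u` with ∂ₜφ finite. -/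
theorem ContinuousInL2.lintegral_sq_lt_top {N : ℕ} {Ω : Set (Space N)} {T : ℝ}
    {u : ℝ → Space N → ℝ} (hu : ContinuousInL2 Ω T u) :
    ∫⁻ t in Ioo 0 T, ∫⁻ x in Ω, ENNReal.ofReal (u t x ^ 2) < ⊤ := by
  obtain ⟨C, hC⟩ : ∃ C : ℝ≥0∞, C < ⊤ ∧
      ∀ t ∈ Icc 0 T, eLpNorm (u t) 2 (volume.restrict Ω) ≤ C := by
    refine isCompact_Icc.induction_on
      (p := fun S => ∃ C : ℝ≥0∞, C < ⊤ ∧ ∀ t ∈ S ∩ Icc 0 T,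
        eLpNorm (u t) 2 (volume.restrict Ω) ≤ C) ?_ ?_ ?_ ?_ |>.imp fun C hC =>
          ⟨hC.1, fun t ht => hC.2 t ⟨ht, ht⟩⟩
    · exact ⟨0, by simp, by simp⟩
    · rintro S S' h ⟨C, hC, hS⟩
      exact ⟨C, hC, fun t ht => hS t ⟨h ht.1, ht.2⟩⟩
    · rintro S S' ⟨C, hC, hS⟩ ⟨C', hC', hS'⟩
      refine ⟨max C C', max_lt hC hC', fun t ht => ?_⟩
      rcases ht.1 with h | h
      · exact (hS t ⟨h, ht.2⟩).trans (le_max_left _ _)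
      · exact (hS' t ⟨h, ht.2⟩).trans (le_max_right _ _)
    · intro t ht
      have h1 := (hu.tendsto t ht).eventually (gt_mem_nhds one_pos)
      refine ⟨_, h1, eLpNorm (u t) 2 (volume.restrict Ω) + 1,
        ENNReal.add_lt_top.2 ⟨(hu.memLp t ht).2, by simp⟩, fun τ hτ => ?_⟩
      have h2 := eLpNorm_add_le (μ := volume.restrict Ω) (p := 2) (hu.memLp t ht).1
        ((hu.memLp τ hτ.2).1.sub (hu.memLp t ht).1) (by norm_num)
      rw [add_sub_cancel] at h2
      exact h2.trans (add_le_add le_rfl (le_of_lt hτ.1))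
  refine lt_of_le_of_lt (setLIntegral_mono' measurableSet_Ioo (g := fun _ => C ^ 2)
    fun t ht => ?_) ?_
  · rw [← eLpNorm_two_sq]
    exact pow_le_pow_left' (hC.2 t (Ioo_subset_Icc_self ht)) 2
  · rw [lintegral_const]
    exact ENNReal.mul_lt_top (ENNReal.pow_lt_top hC.1) (by simp)

/-! ### The mollified map as a comparison map -/

theorem energy_eq_of_density {N : ℕ} {H : Space N → Space N → ℝ → ℝ}
    {F : Space N × Space N → ℝ → ℝ}
    (hF : ∀ᵐ z : Space N × Space N, ∀ ξ, H z.1 z.2 ξ / ‖z.1 - z.2‖ ^ N = F z ξ)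
    (ψ : Space N → ℝ) : energy H ψ = ∫⁻ z, ENNReal.ofReal (F z (ψ z.1 - ψ z.2)) := by
  refine lintegral_congr_ae ?_
  filter_upwards [hF] with z hz
  rw [hz]

theorem measurable_difference {N : ℕ} {v : ℝ → Space N → ℝ}
    (hv : Measurable (Function.uncurry v)) :
    Measurable (Function.uncurry fun t (z : Space N × Space N) => v t z.1 - v t z.2) := by
  have h1 : Measurable fun q : ℝ × (Space N × Space N) => v q.1 q.2.1 :=
    hv.comp (f := fun q : ℝ × (Space N × Space N) => (q.1, q.2.1)) (by fun_prop)
  have h2 : Measurable fun q : ℝ × (Space N × Space N) => v q.1 q.2.2 :=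
    hv.comp (f := fun q : ℝ × (Space N × Space N) => (q.1, q.2.2)) (by fun_prop)
  exact h1.sub h2

theorem measurable_energy {N : ℕ} {s p A : ℝ} (hA : 0 ≤ A) {H : Space N → Space N → ℝ → ℝ}
    (hH : StructureCondition s p A H) {v : ℝ → Space N → ℝ}
    (hv : Measurable (Function.uncurry v)) : Measurable fun t => energy H (v t) := by
  obtain ⟨F, hF, -, -, -, hFH⟩ := exists_measurable_density hA hH
  simp_rw [energy_eq_of_density hFH]
  have : Measurable fun q : ℝ × (Space N × Space N) =>
      ENNReal.ofReal (F q.2 (v q.1 q.2.1 - v q.1 q.2.2)) :=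
    (hF.comp (measurable_snd.prodMk (measurable_difference hv))).ennreal_ofReal
  exact this.lintegral_prod_right'

theorem integrableOn_exp_kernel_mul {h t : ℝ} {γ : ℝ → ℝ} (hγ : IntegrableOn γ (Ioo 0 t)) :
    IntegrableOn (fun s => 1 / h * Real.exp ((s - t) / h) * γ s) (Ioo 0 t) := by
  rw [← integrableOn_Icc_iff_integrableOn_Ioo] at hγ ⊢
  exact hγ.continuousOn_mul (by fun_prop) isCompact_Icc

theorem expAverage_sub {h a b t : ℝ} {γ η : ℝ → ℝ} (hγ : IntegrableOn γ (Ioo 0 t))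
    (hη : IntegrableOn η (Ioo 0 t)) :
    expAverage h (a - b) (fun s => γ s - η s) t = expAverage h a γ t - expAverage h b η t := by
  simp only [expAverage, mul_sub]
  rw [integral_sub (integrableOn_exp_kernel_mul hγ) (integrableOn_exp_kernel_mul hη)]
  ring

/-- The averaging measure has mass 1, so constants are preserved. This is why mollification keeps
the time-independent values outside Ω. -/
theorem expAverage_eq_const {h c t : ℝ} {γ : ℝ → ℝ} (ht : 0 ≤ t)
    (hγ : ∀ᵐ s, s ∈ Ioo 0 t → γ s = c) : expAverage h c γ t = c := by
  have : ∫ s in Ioo 0 t, 1 / h * Real.exp ((s - t) / h) * γ s =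
      (∫ s in Ioo 0 t, 1 / h * Real.exp ((s - t) / h)) * c := by
    rw [← integral_mul_const]
    refine setIntegral_congr_ae measurableSet_Ioo ?_
    filter_upwards [hγ] with s hs hst
    rw [hs hst]
  rw [expAverage, this, integral_exp_kernel ht]
  ring

theorem convexOn_abs_rpow {p : ℝ} (hp : 1 ≤ p) : ConvexOn ℝ univ fun ξ : ℝ => |ξ| ^ p := by
  have h1 : ConvexOn ℝ univ fun ξ : ℝ => ‖ξ‖ := convexOn_norm convex_univ
  have himg : (fun ξ : ℝ => ‖ξ‖) '' univ = Ici 0 := by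
    ext y
    simp only [mem_image, mem_univ, true_and, mem_Ici]
    exact ⟨fun ⟨x, hx⟩ => hx ▸ norm_nonneg x, fun hy => ⟨y, by simpa using hy⟩⟩
  refine ConvexOn.comp (g := fun r : ℝ => r ^ p) (f := fun ξ : ℝ => ‖ξ‖) ?_ h1 ?_
  · rw [himg]; exact convexOn_rpow hp
  · rw [himg]
    exact fun x hx y _ hxy => Real.rpow_le_rpow hx hxy (by linarith)

theorem lintegral_abs_rpow_expAverage_le {X : Type*} [MeasurableSpace X] {μ : Measure X} [SFinite μ]
    {p h T : ℝ} (hp : 1 ≤ p) (hh : 0 < h) (hT : 0 ≤ T) {a : X → ℝ} {g : ℝ → X → ℝ}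
    (ha : Measurable a) (hg : Measurable (Function.uncurry g))
    (hgi : ∀ x, IntegrableOn (fun t => g t x) (Ioo 0 T)) :
    ∫⁻ t in Ioo 0 T, ∫⁻ x, ENNReal.ofReal (|expAverage h (a x) (fun s => g s x) t| ^ p) ∂μ ≤
      ENNReal.ofReal h * ∫⁻ x, ENNReal.ofReal (|a x| ^ p) ∂μ +
        ∫⁻ t in Ioo 0 T, ∫⁻ x, ENNReal.ofReal (|g t x| ^ p) ∂μ :=
  lintegral_ofReal_expAverage_le (F := fun _ ξ => |ξ| ^ p) hh hT
    (by unfold Function.uncurry; fun_prop)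
    (fun _ => convexOn_abs_rpow hp)
    (fun _ => continuous_abs.rpow_const fun _ => Or.inr (by linarith))
    (fun _ _ => by positivity) ha hg hgi

/-- Mollification is linear, so the difference of v at x and y is the mollification of the
differences. Jensen's inequality is then applied on the space of pairs (x,y). -/
theorem timeEnergy_expAverage_le {N : ℕ} {s p A h T : ℝ} (hA : 0 ≤ A) (hh : 0 < h) (hT : 0 ≤ T)
    {H : Space N → Space N → ℝ → ℝ} (hH : StructureCondition s p A H) {a : Space N → ℝ}
    {g : ℝ → Space N → ℝ} (ha : Measurable a) (hg : Measurable (Function.uncurry g))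
    (hgi : ∀ x, IntegrableOn (fun t => g t x) (Ioo 0 T)) :
    timeEnergy H T (fun t x => expAverage h (a x) (fun s => g s x) t) ≤
      ENNReal.ofReal h * energy H a + timeEnergy H T g := by
  obtain ⟨F, hF, hF1, hF2, hF3, hFH⟩ := exists_measurable_density hA hH
  simp only [timeEnergy, energy_eq_of_density hFH]
  refine le_trans (le_of_eq ?_) (lintegral_ofReal_expAverage_le hh hT hF hF1 hF2 hF3
    (α := fun z => a z.1 - a z.2) (γ := fun t z => g t z.1 - g t z.2)
    ((ha.comp measurable_fst).sub (ha.comp measurable_snd)) (measurable_difference hg)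
    (fun z => (hgi z.1).sub (hgi z.2)))
  refine setLIntegral_congr_fun measurableSet_Ioo fun t ht => ?_
  refine lintegral_congr fun z => ?_
  rw [expAverage_sub ((hgi _).mono_set (Ioo_subset_Ioo_right ht.2.le))
    ((hgi _).mono_set (Ioo_subset_Ioo_right ht.2.le))]

theorem isComparisonMap_const {N : ℕ} {Ω : Set (Space N)} {s p T : ℝ} (hp : 1 ≤ p) (hT : 0 ≤ T)
    {u₀ : Space N → ℝ} (hu₀ : MemSobolev s p u₀) (hu₀2 : MemLp u₀ 2 (volume.restrict Ω)) :
    IsComparisonMap Ω s p u₀ T (fun _ => u₀) (fun _ _ => 0) := by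
  have hp0 : 0 < p := by linarith
  have hm : ∀ Ω' : Set (Space N), AEStronglyMeasurable (Function.uncurry fun _ : ℝ => u₀)
      (cylinderMeasure Ω' T) := fun Ω' =>
    (hu₀.1.aestronglyMeasurable.restrict (s := Ω')).comp_quasiMeasurePreserving
      Measure.quasiMeasurePreserving_snd
  refine ⟨⟨hm univ, ae_of_all _ fun _ _ => hu₀, ?_⟩, ⟨?_, ?_⟩, ⟨fun _ _ => hu₀2, ?_⟩, ?_⟩
  · rw [lintegral_const]
    refine ENNReal.mul_lt_top (ENNReal.rpow_lt_top_of_nonneg hp0.le (ENNReal.add_lt_top.2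
      ⟨hu₀.1.2, ENNReal.rpow_lt_top_of_nonneg (by positivity) hu₀.2.ne⟩).ne) (by simp)
  · simp only [sub_self]
    refine memLpSobolev_of_lintegral_lt_top hp measurable_const ?_ ?_
    · simp [Real.zero_rpow hp0.ne']
    · simp [gagliardoPow, Real.zero_rpow hp0.ne']
  · refine ae_of_all _ fun t _ => ⟨⟨?_, ?_⟩, ?_⟩
    · simp only [sub_self]; exact MemLp.zero'
    · simp [gagliardoPow, Real.zero_rpow hp0.ne']
    · simp
  · intro t _
    simp [tendsto_const_nhds]
  · refine hasWeakTimeDerivL2_of_primitive (a := u₀) hT ?_ MemLp.zero' (by simp) (by simp)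
    rw [memLp_cylinderMeasure_iff (hm Ω), lintegral_const]
    exact ENNReal.mul_lt_top ((memLp_two_iff_lintegral hu₀2.1).1 hu₀2) (by simp)

/-- The exponential mollification of an admissible map of finite energy is a comparison map. -/
theorem isComparisonMap_expAverage {N : ℕ} {Ω : Set (Space N)} (hΩ : MeasurableSet Ω)
    {s p A h T : ℝ} (hp : 1 ≤ p) (hA : 0 < A) (hh : 0 < h) (hT : 0 ≤ T)
    {H : Space N → Space N → ℝ → ℝ} (hH : StructureCondition s p A H)
    {u₀ : Space N → ℝ} (hu₀ : MemSobolev s p u₀) {a : Space N → ℝ} {g : ℝ → Space N → ℝ}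
    (ha : Measurable a) (hap : MemLp a (ENNReal.ofReal p) volume) (haE : energy H a < ⊤)
    (ha2 : MemLp a 2 (volume.restrict Ω)) (ha0 : ∀ᵐ x, x ∉ Ω → a x = u₀ x)
    (hg : Measurable (Function.uncurry g))
    (hgi : ∀ x, IntegrableOn (fun t => g t x) (Ioo 0 T))
    (hgp : ∫⁻ t in Ioo 0 T, ∫⁻ x, ENNReal.ofReal (|g t x| ^ p) < ⊤)
    (hgE : timeEnergy H T g < ⊤)
    (hg2 : MemLp (Function.uncurry g) 2 (cylinderMeasure Ω T))
    (hg0 : ∀ᵐ t, t ∈ Ioo 0 T → ∀ᵐ x, x ∉ Ω → g t x = u₀ x) :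
    IsComparisonMap Ω s p u₀ T (fun t x => expAverage h (a x) (fun s => g s x) t)
      (fun t x => (g t x - expAverage h (a x) (fun s => g s x) t) / h) := by
  have hp0 : 0 < p := by linarith
  set v : ℝ → Space N → ℝ := fun t x => expAverage h (a x) (fun s => g s x) t with hv
  set w : ℝ → Space N → ℝ := fun t x => (g t x - v t x) / h with hw
  have hvm : Measurable (Function.uncurry v) := measurable_expAverage h ha hg
  have hwm : Measurable (Function.uncurry w) := (hg.sub hvm).div_const h
  have hgI : ∀ x, IntervalIntegrable (fun t => g t x) volume 0 T := fun x => by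
    rw [intervalIntegrable_iff_integrableOn_Ioo_of_le hT]; exact hgi x
  have hvp : ∫⁻ t in Ioo 0 T, ∫⁻ x, ENNReal.ofReal (|v t x| ^ p) < ⊤ := by
    refine (lintegral_abs_rpow_expAverage_le hp hh hT ha hg hgi).trans_lt
      (ENNReal.add_lt_top.2 ⟨ENNReal.mul_lt_top (by simp) ?_, hgp⟩)
    rw [← eLpNorm_ofReal_rpow hp0]
    exact ENNReal.rpow_lt_top_of_nonneg hp0.le hap.2.ne
  have hvE : timeEnergy H T v < ⊤ :=
    (timeEnergy_expAverage_le hA.le hh hT hH ha hg hgi).trans_lt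
      (ENNReal.add_lt_top.2 ⟨ENNReal.mul_lt_top (by simp) haE, hgE⟩)
  -- The Gagliardo bound for v is not taken from one for g; it comes from the energy through
  -- coercivity.
  have hvg : ∫⁻ t in Ioo 0 T, gagliardoPow s p (v t) < ⊤ := by
    refine (lintegral_mono fun t => gagliardoPow_le_energy hp0 hA hH (v t)).trans_lt ?_
    rw [lintegral_const_mul' _ _ ENNReal.ofReal_ne_top]
    exact ENNReal.mul_lt_top (by simp) hvE
  have hv2 : MemLp (Function.uncurry v) 2 (cylinderMeasure Ω T) := by
    rw [memLp_cylinderMeasure_iff hvm.aestronglyMeasurable]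
    have h1 := lintegral_abs_rpow_expAverage_le (μ := volume.restrict Ω) (p := 2) one_le_two
      hh hT ha hg hgi
    simp only [Real.rpow_ofNat, sq_abs] at h1
    refine h1.trans_lt (ENNReal.add_lt_top.2 ⟨ENNReal.mul_lt_top (by simp)
      ((memLp_two_iff_lintegral ha2.1).1 ha2), (memLp_cylinderMeasure_iff hg2.1).1 hg2⟩)
  have hw2 : MemLp (Function.uncurry w) 2 (cylinderMeasure Ω T) := by
    have := (hg2.sub hv2).mul_const (1 / h)
    refine this.ae_eq (ae_of_all _ fun z => ?_)
    simp only [hw, Function.uncurry, Pi.sub_apply]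
    ring
  have hwi : ∀ x, IntervalIntegrable (fun t => w t x) volume 0 T := fun x =>
    ((hgI x).sub (intervalIntegrable_expAverage hT (hgI x))).div_const h
  have hvw : ∀ x, ∀ t ∈ Icc 0 T, v t x = a x + ∫ s in 0..t, w s x := fun x t ht =>
    expAverage_eq_add_integral (hgI x) ht
  -- The exterior condition on g holds for a.e. t and then a.e. x. Exchanging the quantifiers makes
  -- g(·,x) a.e. constant in time for a.e. exterior x, so that v(t,x) = u₀(x) for every t in (0,T).
  have hv0 : ∀ᵐ x, x ∉ Ω → ∀ t ∈ Ioo 0 T, v t x = u₀ x := by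
    set b := hu₀.1.aestronglyMeasurable.mk u₀ with hb
    have hub : u₀ =ᵐ[volume] b := hu₀.1.aestronglyMeasurable.ae_eq_mk
    have hbm : Measurable b := hu₀.1.aestronglyMeasurable.stronglyMeasurable_mk.measurable
    have hgb : ∀ᵐ t ∂((volume : Measure ℝ).restrict (Ioo 0 T)), ∀ᵐ x : Space N,
        x ∉ Ω → g t x = b x := by
      rw [ae_restrict_iff' measurableSet_Ioo]
      filter_upwards [hg0] with t ht htT
      filter_upwards [ht htT, hub] with x hx hx' hxΩ
      rw [hx hxΩ, hx']
    have hset : MeasurableSet {q : ℝ × Space N | q.2 ∉ Ω → g q.1 q.2 = b q.2} := by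
      have h1 : MeasurableSet {q : ℝ × Space N | q.2 ∈ Ω} := measurable_snd hΩ
      have h2 : MeasurableSet {q : ℝ × Space N | g q.1 q.2 = b q.2} :=
        measurableSet_eq_fun hg (hbm.comp measurable_snd)
      convert! h1.union h2 using 1
      ext q
      simp only [mem_ofPred_eq, mem_union]
      tauto
    have hgb' := Measure.ae_ae_comm hset |>.1 hgb
    filter_upwards [hgb', hub, ha0] with x hx hxb hxa hxΩ t ht
    have hx2 := (ae_restrict_iff' measurableSet_Ioo).1 hx
    simp only [hv]
    rw [hxa hxΩ]
    refine expAverage_eq_const ht.1.le ?_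
    filter_upwards [hx2] with r hr hrt
    rw [hr ⟨hrt.1, hrt.2.trans ht.2⟩ hxΩ, hxb]
  have hvu : MemLpSobolev s p T (fun t x => v t x - u₀ x) :=
    memLpSobolev_sub hp hu₀ hvm hvp hvg
  refine ⟨memLpSobolev_of_lintegral_lt_top hp hvm hvp hvg, ⟨hvu, ?_⟩, ?_, ?_⟩
  · filter_upwards [hvu.mem_sobolev] with t ht htT
    refine ⟨ht htT, ?_⟩
    filter_upwards [hv0] with x hx hxΩ
    rw [hx hxΩ t htT, sub_self]
  · exact continuousInL2_of_primitive hT ha2 (fun t => hvm.comp measurable_prodMk_left) hwm hw2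
      hwi hvw
  · exact hasWeakTimeDerivL2_of_primitive hT hv2 hw2 hwi hvw

/-! ### The minimality inequality -/

theorem le_of_forall_pos_le_add_mul {x y c : ℝ} (h : ∀ r : ℝ, 0 < r → x ≤ y + r * c) :
    x ≤ y := by
  have hc : Continuous fun r : ℝ => y + r * c := by fun_prop
  have ht : Tendsto (fun r : ℝ => y + r * c) (𝓝[>] 0) (𝓝 y) := by
    have := (hc.tendsto 0).mono_left (nhdsWithin_le_nhds (s := Ioi 0))
    simpa using this
  exact ge_of_tendsto ht (by filter_upwards [self_mem_nhdsWithin] with r hr using h r hr)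

theorem ereal_add_le_add_iff {a b : ℝ≥0∞} (ha : a ≠ ⊤) (hb : b ≠ ⊤) (c d : ℝ) :
    (a : EReal) + (c : EReal) ≤ (b : EReal) + (d : EReal) ↔ a.toReal + c ≤ b.toReal + d := by
  rw [← EReal.coe_ennreal_toReal ha, ← EReal.coe_ennreal_toReal hb, ← EReal.coe_add,
    ← EReal.coe_add, EReal.coe_le_coe_iff]

theorem cylinderMeasure_absolutelyContinuous {N : ℕ} (Ω : Set (Space N)) (T : ℝ) :
    cylinderMeasure Ω T ≪ cylinderMeasure univ T :=
  Measure.AbsolutelyContinuous.rfl.prod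
    (Measure.absolutelyContinuous_of_le (Measure.restrict_mono (subset_univ _) le_rfl))

/-- A jointly measurable representative whose time slices are all integrable. -/
theorem MemLpSobolev.exists_measurable_rep {N : ℕ} {s p T : ℝ} (hp : 1 ≤ p)
    {u : ℝ → Space N → ℝ} (hu : MemLpSobolev s p T u) :
    ∃ G : ℝ → Space N → ℝ, Measurable (Function.uncurry G) ∧
      Function.uncurry u =ᵐ[cylinderMeasure univ T] Function.uncurry G ∧
      ∀ x, IntegrableOn (fun t => G t x) (Ioo 0 T) := by
  classical
  have hp0 : 0 < p := by linarith
  set G₁ : ℝ → Space N → ℝ := Function.curry (hu.aestronglyMeasurable.mk (Function.uncurry u))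
    with hG₁
  have hG₁m : Measurable (Function.uncurry G₁) := by
    rw [hG₁, Function.uncurry_curry]
    exact hu.aestronglyMeasurable.stronglyMeasurable_mk.measurable
  have huG₁ : Function.uncurry u =ᵐ[cylinderMeasure univ T] Function.uncurry G₁ := by
    rw [hG₁, Function.uncurry_curry]
    exact hu.aestronglyMeasurable.ae_eq_mk
  have hJ : Measurable fun q : ℝ × Space N => ENNReal.ofReal (|G₁ q.1 q.2| ^ p) :=
    (hG₁m.abs.pow_const p).ennreal_ofReal
  have hI : Measurable fun x => ∫⁻ t in Ioo 0 T, ENNReal.ofReal (|G₁ t x| ^ p) :=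
    hJ.lintegral_prod_left'
  have hfin : ∫⁻ x, ∫⁻ t in Ioo 0 T, ENNReal.ofReal (|G₁ t x| ^ p) < ⊤ := by
    rw [← lintegral_lintegral_swap (f := fun t x => ENNReal.ofReal (|G₁ t x| ^ p)) hJ.aemeasurable]
    refine lt_of_le_of_lt (le_of_eq (lintegral_congr_ae ?_)) (hu.lintegral_abs_rpow_lt_top hp0)
    have := Measure.ae_ae_of_ae_prod huG₁
    filter_upwards [this] with t ht
    rw [Measure.restrict_univ] at ht
    refine lintegral_congr_ae ?_
    filter_upwards [ht] with x hx
    simp only [Function.uncurry] at hx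
    rw [hx]
  -- By Tonelli a.e. time slice in x lies in L^p(0,T), hence in L¹ of this bounded interval. On the
  -- exceptional null set of x the map is replaced by zero.
  set S := {x | ∫⁻ t in Ioo 0 T, ENNReal.ofReal (|G₁ t x| ^ p) < ⊤} with hS
  have hSm : MeasurableSet S := measurableSet_lt hI measurable_const
  have hSae : ∀ᵐ x, x ∈ S := ae_lt_top hI hfin.ne
  refine ⟨fun t x => if x ∈ S then G₁ t x else 0,
    Measurable.ite (measurable_snd hSm) hG₁m measurable_const, ?_, fun x => ?_⟩
  · have h2 : ∀ᵐ q ∂(cylinderMeasure (univ : Set (Space N)) T), q.2 ∈ S := by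
      rw [cylinderMeasure, Measure.restrict_univ]
      exact Measure.quasiMeasurePreserving_snd.ae hSae
    filter_upwards [huG₁, h2] with q hq hqS
    rw [hq]
    simp [Function.uncurry, hqS]
  · by_cases hx : x ∈ S
    · simp only [hx, if_true]
      have hm : MemLp (fun t => G₁ t x) (ENNReal.ofReal p) (volume.restrict (Ioo 0 T)) := by
        refine ⟨(hG₁m.comp measurable_prodMk_right).aestronglyMeasurable, ?_⟩
        rw [← ENNReal.rpow_lt_top_iff_of_pos hp0, eLpNorm_ofReal_rpow hp0]
        exact hx
      exact hm.integrable (by simpa using hp)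
    · simp only [hx, if_false]
      exact integrableOn_zero

/-- Testing the weak derivative of φ with φ itself shows that the integral equals its own negative.
-/
theorem IsTestFunction.integral_mul_timeDeriv {N : ℕ} {Ω : Set (Space N)} {T : ℝ} (hT : 0 ≤ T)
    {φ : ℝ → Space N → ℝ} (hφ : IsTestFunction Ω T φ) :
    ∫ z, φ z.1 z.2 * timeDeriv φ z.1 z.2 ∂(cylinderMeasure Ω T) = 0 := by
  have hc : ∀ x, Continuous fun t => timeDeriv φ t x := fun x =>
    (hφ.isTestFunction_timeDeriv.contDiff_slice x).continuous
  have hw := hasWeakTimeDerivL2_of_primitive (a := fun _ => 0) hT (hφ.memLp (Ω' := Ω) 2)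
    (hφ.isTestFunction_timeDeriv.memLp 2) (fun x => (hc x).intervalIntegrable _ _) fun x t _ => by
      have h0 : φ 0 x = 0 := hφ.apply_eq_zero fun h => lt_irrefl _ h.1.1
      have := intervalIntegral.integral_eq_sub_of_hasDerivAt (a := 0) (b := t)
        (f := fun t => φ t x) (f' := fun t => timeDeriv φ t x)
        (fun r _ => (((hφ.contDiff_slice x).differentiable (by simp)) r).hasDerivAt)
        ((hc x).intervalIntegrable _ _)
      rw [this, h0]; ring
  have h := hw.integral_eq φ hφ
  simp_rw [mul_comm (timeDeriv φ _ _)] at h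
  linarith

/-- Estimate of the time term for a map `v` with `h ∂ₜ v = u + φ - v`. -/
theorem integral_timeTerm_le {N : ℕ} {Ω : Set (Space N)} {T h : ℝ} (hT : 0 ≤ T) (hh : 0 < h)
    {u v w φ : ℝ → Space N → ℝ} (hφ : IsTestFunction Ω T φ)
    (hu : MemLp (Function.uncurry u) 2 (cylinderMeasure Ω T))
    (hvw : HasWeakTimeDerivL2 Ω T v w)
    (hw : ∀ᵐ z ∂(cylinderMeasure Ω T), h * w z.1 z.2 = u z.1 z.2 + φ z.1 z.2 - v z.1 z.2) :
    ∫ z, w z.1 z.2 * (v z.1 z.2 - u z.1 z.2) ∂(cylinderMeasure Ω T) ≤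
      - (∫ z, u z.1 z.2 * timeDeriv φ z.1 z.2 ∂(cylinderMeasure Ω T)) +
        h / 4 * ∫ z, timeDeriv φ z.1 z.2 ^ 2 ∂(cylinderMeasure Ω T) := by
  set μ := cylinderMeasure Ω T with hμ
  have hφ2 : MemLp (fun z : ℝ × Space N => φ z.1 z.2) 2 μ := hφ.memLp 2
  have hd2 : MemLp (fun z : ℝ × Space N => timeDeriv φ z.1 z.2) 2 μ :=
    hφ.isTestFunction_timeDeriv.memLp 2
  have hw2 : MemLp (fun z : ℝ × Space N => w z.1 z.2) 2 μ := hvw.memLp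
  have hu2 : MemLp (fun z : ℝ × Space N => u z.1 z.2) 2 μ := hu
  have iww : Integrable (fun z : ℝ × Space N => w z.1 z.2 * w z.1 z.2) μ := hw2.integrable_mul hw2
  have iwφ : Integrable (fun z : ℝ × Space N => w z.1 z.2 * φ z.1 z.2) μ := hw2.integrable_mul hφ2
  have iwd : Integrable (fun z : ℝ × Space N => w z.1 z.2 * timeDeriv φ z.1 z.2) μ :=
    hw2.integrable_mul hd2
  have iud : Integrable (fun z : ℝ × Space N => u z.1 z.2 * timeDeriv φ z.1 z.2) μ :=
    hu2.integrable_mul hd2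
  have iφd : Integrable (fun z : ℝ × Space N => φ z.1 z.2 * timeDeriv φ z.1 z.2) μ :=
    hφ2.integrable_mul hd2
  have idd : Integrable (fun z : ℝ × Space N => timeDeriv φ z.1 z.2 ^ 2) μ :=
    (hd2.integrable_mul hd2).congr (ae_of_all _ fun z => (pow_two _).symm)
  have iuφd : Integrable (fun z : ℝ × Space N =>
      u z.1 z.2 * timeDeriv φ z.1 z.2 + φ z.1 z.2 * timeDeriv φ z.1 z.2) μ := iud.add iφd
  have e1 : ∫ z, w z.1 z.2 * (v z.1 z.2 - u z.1 z.2) ∂μ =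
      (∫ z, w z.1 z.2 * φ z.1 z.2 ∂μ) - h * ∫ z, w z.1 z.2 * w z.1 z.2 ∂μ := by
    rw [← integral_const_mul, ← integral_sub iwφ (iww.const_mul h)]
    refine integral_congr_ae ?_
    filter_upwards [hw] with z hz
    linear_combination (w z.1 z.2) * hz
  have e2 : ∫ z, v z.1 z.2 * timeDeriv φ z.1 z.2 ∂μ =
      (∫ z, u z.1 z.2 * timeDeriv φ z.1 z.2 ∂μ) + (∫ z, φ z.1 z.2 * timeDeriv φ z.1 z.2 ∂μ) -
        h * ∫ z, w z.1 z.2 * timeDeriv φ z.1 z.2 ∂μ := by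
    rw [← integral_const_mul, ← integral_add iud iφd,
      ← integral_sub iuφd (iwd.const_mul h)]
    refine integral_congr_ae ?_
    filter_upwards [hw] with z hz
    linear_combination (timeDeriv φ z.1 z.2) * hz
  have e3 := hvw.integral_eq φ hφ
  have e4 := hφ.integral_mul_timeDeriv hT
  -- Young's inequality w d ≤ w² + d²/4; the coefficient of w² must be exactly 1 to cancel -h ∫ w²
  -- in `e1`.
  have e5 : h * (∫ z, w z.1 z.2 * timeDeriv φ z.1 z.2 ∂μ) ≤
      h * (∫ z, w z.1 z.2 * w z.1 z.2 ∂μ) + h / 4 * ∫ z, timeDeriv φ z.1 z.2 ^ 2 ∂μ := by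
    rw [← integral_const_mul, ← integral_const_mul, ← integral_const_mul,
      ← integral_add (iww.const_mul h) (idd.const_mul (h / 4))]
    refine integral_mono (iwd.const_mul h) ((iww.const_mul h).add (idd.const_mul (h / 4)))
      fun z => ?_
    simp only
    nlinarith [mul_nonneg hh.le (sq_nonneg (w z.1 z.2 - timeDeriv φ z.1 z.2 / 2))]
  rw [← hμ] at e3 e4
  linarith

/-- Comparison with the constant-in-time map u₀, whose energy on (0,T) is finite: all remaining
terms are real numbers, so the energy of `u` cannot be infinite. -/
theorem IsVariationalSolution.timeEnergy_lt_top {N : ℕ} {Ω : Set (Space N)} {s p : ℝ} (hp : 1 ≤ p)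
    {H : Space N → Space N → ℝ → ℝ} {u₀ : Space N → ℝ} (hu₀ : IsAdmissibleDatum Ω s p H u₀)
    {u : ℝ → Space N → ℝ} (hu : IsVariationalSolution Ω s p H u₀ u) {T : ℝ} (hT : 0 < T) :
    timeEnergy H T u < ⊤ := by
  have h := hu.variational_inequality T hT _ _ (isComparisonMap_const hp hT.le hu₀.1 hu₀.2)
  by_contra hcon
  rw [not_lt, top_le_iff] at hcon
  have hfin : timeEnergy H T (fun _ => u₀) ≠ ⊤ := by
    rw [timeEnergy, lintegral_const]
    exact (ENNReal.mul_lt_top hu₀.3 (by simp)).ne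
  rw [hcon, EReal.coe_ennreal_top, EReal.top_add_coe, top_le_iff,
    ← EReal.coe_ennreal_toReal hfin, ← EReal.coe_add] at h
  exact EReal.coe_ne_top _ h

theorem IsVariationalSolution.minimality {N : ℕ} {Ω : Set (Space N)} (hΩ : MeasurableSet Ω)
    {s p A : ℝ} (hp : 1 ≤ p) (hA : 0 < A)
    {H : Space N → Space N → ℝ → ℝ} (hH : StructureCondition s p A H)
    {u₀ : Space N → ℝ} (hu₀ : IsAdmissibleDatum Ω s p H u₀)
    {u : ℝ → Space N → ℝ} (hu : IsVariationalSolution Ω s p H u₀ u) {T : ℝ} (hT : 0 < T)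
    {φ : ℝ → Space N → ℝ} (hφ : IsTestFunction Ω T φ)
    (hE : timeEnergy H T (fun t x => u t x + φ t x) < ⊤) :
    (∫ z, u z.1 z.2 * timeDeriv φ z.1 z.2 ∂(cylinderMeasure Ω T)) + (timeEnergy H T u).toReal ≤
      (timeEnergy H T (fun t x => u t x + φ t x)).toReal := by
  have hp0 : 0 < p := by linarith
  have huE := hu.timeEnergy_lt_top hp hu₀ hT
  have huS := hu.memLpSobolev T hT
  obtain ⟨G, hGm, huG, hGi⟩ := huS.exists_measurable_rep hp
  have huGt : ∀ᵐ t, t ∈ Ioo 0 T → u t =ᵐ[volume] G t := by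
    have := Measure.ae_ae_of_ae_prod huG
    rw [Measure.restrict_univ] at this
    exact (ae_restrict_iff' measurableSet_Ioo).1 this
  have huG' : Function.uncurry u =ᵐ[cylinderMeasure Ω T] Function.uncurry G :=
    (cylinderMeasure_absolutelyContinuous Ω T).ae_le huG
  have hu2 : MemLp (Function.uncurry u) 2 (cylinderMeasure Ω T) := by
    rw [memLp_cylinderMeasure_iff (hGm.aestronglyMeasurable.congr huG'.symm)]
    exact (hu.continuousInL2 T hT).lintegral_sq_lt_top
  set g : ℝ → Space N → ℝ := fun t x => G t x + φ t x with hg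
  have hφm : Measurable (Function.uncurry φ) := hφ.contDiff.continuous.measurable
  have hgm : Measurable (Function.uncurry g) := hGm.add hφm
  have hgt : ∀ᵐ t, t ∈ Ioo 0 T → (fun x => u t x + φ t x) =ᵐ[volume] g t := by
    filter_upwards [huGt] with t ht htT
    filter_upwards [ht htT] with x hx
    simp only [hg, hx]
  have hgi : ∀ x, IntegrableOn (fun t => g t x) (Ioo 0 T) := fun x =>
    (hGi x).add (((hφ.contDiff_slice x).continuous.integrableOn_Icc
      (a := 0) (b := T)).mono_set Ioo_subset_Icc_self)
  have hgE : timeEnergy H T (fun t x => u t x + φ t x) = timeEnergy H T g := by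
    refine setLIntegral_congr_fun_ae measurableSet_Ioo ?_
    filter_upwards [hgt] with t ht htT
    exact energy_congr H (ht htT)
  have huGE : timeEnergy H T u = timeEnergy H T G := by
    refine setLIntegral_congr_fun_ae measurableSet_Ioo ?_
    filter_upwards [huGt] with t ht htT
    exact energy_congr H (ht htT)
  have hgp : ∫⁻ t in Ioo 0 T, ∫⁻ x, ENNReal.ofReal (|g t x| ^ p) < ⊤ := by
    have hGp : MemLp (Function.uncurry G) (ENNReal.ofReal p) (cylinderMeasure univ T) := by
      refine MemLp.ae_eq huG ⟨huS.1, ?_⟩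
      have hm : AEMeasurable (fun z => ENNReal.ofReal (|Function.uncurry u z| ^ p))
          (cylinderMeasure univ T) :=
        ((measurable_norm.comp_aemeasurable huS.1.aemeasurable).pow_const p).ennreal_ofReal
      rw [← ENNReal.rpow_lt_top_iff_of_pos hp0, eLpNorm_ofReal_rpow hp0,
        lintegral_cylinderMeasure hm]
      simpa only [Measure.restrict_univ, Function.uncurry_apply_pair] using
        huS.lintegral_abs_rpow_lt_top hp0
    have hgP : MemLp (Function.uncurry g) (ENNReal.ofReal p) (cylinderMeasure univ T) :=
      hGp.add (hφ.memLp (ENNReal.ofReal p))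
    have h1 := hgP.2
    rw [← ENNReal.rpow_lt_top_iff_of_pos hp0, eLpNorm_ofReal_rpow hp0,
      lintegral_cylinderMeasure (hgm.abs.pow_const p).ennreal_ofReal.aemeasurable] at h1
    simpa only [Measure.restrict_univ, Function.uncurry_apply_pair] using h1
  have hg2 : MemLp (Function.uncurry g) 2 (cylinderMeasure Ω T) :=
    (hu2.ae_eq huG').add (hφ.memLp 2)
  have hg0 : ∀ᵐ t, t ∈ Ioo 0 T → ∀ᵐ x, x ∉ Ω → g t x = u₀ x := by
    filter_upwards [(hu.boundary T hT).mem_sobolevZero, huGt] with t ht1 ht2 htT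
    filter_upwards [(ht1 htT).2, ht2 htT] with x hx1 hx2 hxΩ
    have h0 : φ t x = 0 := hφ.apply_eq_zero fun h => hxΩ h.2
    simp only [hg, h0, add_zero, ← hx2]
    exact sub_eq_zero.1 (hx1 hxΩ)
  set D := ∫ z, timeDeriv φ z.1 z.2 ^ 2 ∂(cylinderMeasure Ω T) with hD
  set I := ∫ z, u z.1 z.2 * timeDeriv φ z.1 z.2 ∂(cylinderMeasure Ω T) with hI
  have approx : ∀ δ : ℝ, 0 < δ → (timeEnergy H T u).toReal - δ ^ 2 / 2 ≤
      (timeEnergy H T g).toReal - I := by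
    intro δ hδ
    -- The first four properties hold for a.e. time, and L² closeness to u(0) holds on some interval
    -- (0,η). As this interval has positive measure, a common time exists.
    obtain ⟨t₀, hEt, hGt, hSt, hbt, hδt, ht₀⟩ : ∃ t₀, energy H (G t₀) < ⊤ ∧
        u t₀ =ᵐ[volume] G t₀ ∧ MemSobolev s p (u t₀) ∧
        (∀ᵐ x, x ∉ Ω → u t₀ x - u₀ x = 0) ∧
        eLpNorm (u t₀ - u 0) 2 (volume.restrict Ω) < ENNReal.ofReal δ ∧ t₀ ∈ Ioo 0 T := by
      have hc := ((hu.continuousInL2 T hT).tendsto 0 (left_mem_Icc.2 hT.le)).eventually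
        (gt_mem_nhds (ENNReal.ofReal_pos.2 hδ))
      have hc' : ∀ᶠ τ in 𝓝[>] (0 : ℝ), τ ∈ Ioo 0 T ∧
          eLpNorm (u τ - u 0) 2 (volume.restrict Ω) < ENNReal.ofReal δ := by
        refine Eventually.and (Ioo_mem_nhdsGT hT) ?_
        have hle : 𝓝[Ioo 0 T] (0 : ℝ) ≤ 𝓝[Icc 0 T] 0 := nhdsWithin_mono _ Ioo_subset_Icc_self
        rw [nhdsWithin_Ioo_eq_nhdsGT hT] at hle
        exact hle hc
      obtain ⟨η, hη, hηs⟩ := mem_nhdsGT_iff_exists_Ioo_subset.1 hc'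
      have hE1 : ∀ᵐ t, t ∈ Ioo 0 T → energy H (G t) < ⊤ :=
        (ae_restrict_iff' measurableSet_Ioo).1
          (ae_lt_top (measurable_energy hA.le hH hGm) (by rw [← timeEnergy, ← huGE]; exact huE.ne))
      have hae : ∀ᵐ t, t ∈ Ioo 0 T → energy H (G t) < ⊤ ∧ u t =ᵐ[volume] G t ∧
          MemSobolev s p (u t) ∧ ∀ᵐ x, x ∉ Ω → u t x - u₀ x = 0 := by
        filter_upwards [hE1, huGt, huS.mem_sobolev, (hu.boundary T hT).mem_sobolevZero]
          with t h1 h2 h3 h4 htT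
        exact ⟨h1 htT, h2 htT, h3 htT, (h4 htT).2⟩
      have hne : (ae ((volume : Measure ℝ).restrict (Ioo 0 η))).NeBot := by
        rw [ae_neBot, Ne, Measure.restrict_eq_zero, Real.volume_Ioo]
        simpa using hη
      obtain ⟨t, ht1, ht2⟩ := ((ae_restrict_of_ae (s := Ioo 0 η) hae).and
        (ae_restrict_mem measurableSet_Ioo)).exists
      obtain ⟨h3, h4⟩ := hηs ht2
      obtain ⟨a1, a2, a3, a4⟩ := ht1 h3
      exact ⟨t, a1, a2, a3, a4, h4, h3⟩
    have hGtΩ : u t₀ =ᵐ[volume.restrict Ω] G t₀ := ae_restrict_of_ae hGt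
    have ha2 : MemLp (G t₀) 2 (volume.restrict Ω) :=
      ((hu.continuousInL2 T hT).memLp t₀ (Ioo_subset_Icc_self ht₀)).ae_eq hGtΩ
    have ham : Measurable (G t₀) := hGm.comp measurable_prodMk_left
    have step : ∀ h : ℝ, 0 < h → (timeEnergy H T u).toReal - δ ^ 2 / 2 ≤
        (timeEnergy H T g).toReal - I + h * ((energy H (G t₀)).toReal + D / 4) := by
      intro h hh
      have hcomp := isComparisonMap_expAverage hΩ hp hA hh hT.le hH hu₀.1 ham (hSt.1.ae_eq hGt)
        hEt ha2 (by
          filter_upwards [hbt, hGt] with x hx1 hx2 hxΩ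
          rw [← hx2]
          exact sub_eq_zero.1 (hx1 hxΩ)) hgm hgi hgp (hgE ▸ hE) hg2 hg0
      have hvE := timeEnergy_expAverage_le hA.le hh hT.le hH ham hgm hgi
      set v : ℝ → Space N → ℝ := fun t x => expAverage h (G t₀ x) (fun s => g s x) t with hv
      set w : ℝ → Space N → ℝ := fun t x => (g t x - v t x) / h with hw
      have hbd : ENNReal.ofReal h * energy H (G t₀) + timeEnergy H T g < ⊤ :=
        ENNReal.add_lt_top.2 ⟨ENNReal.mul_lt_top (by simp) hEt, hgE ▸ hE⟩
      have hvi := hu.variational_inequality T hT v w hcomp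
      rw [ereal_add_le_add_iff huE.ne (hvE.trans_lt hbd).ne] at hvi
      have hvE' : (timeEnergy H T v).toReal ≤
          h * (energy H (G t₀)).toReal + (timeEnergy H T g).toReal := by
        have := ENNReal.toReal_mono hbd.ne hvE
        rwa [ENNReal.toReal_add (ENNReal.mul_lt_top (by simp) hEt).ne (hgE ▸ hE).ne,
          ENNReal.toReal_mul, ENNReal.toReal_ofReal hh.le] at this
      have hterm := integral_timeTerm_le hT.le hh hφ hu2 hcomp.weakTimeDeriv (by
        filter_upwards [huG'] with z hz
        simp only [Function.uncurry] at hz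
        rw [hz]
        simp only [hw, hg]
        field_simp)
      have hv0 : v 0 = G t₀ := by
        ext x; simp [hv, expAverage]
      have hinit : ∫ x in Ω, (v 0 x - u 0 x) ^ 2 ≤ δ ^ 2 := by
        have hm0 := (hu.continuousInL2 T hT).memLp 0 (left_mem_Icc.2 hT.le)
        have hm2 : AEStronglyMeasurable (fun x => (G t₀ x - u 0 x) ^ 2) (volume.restrict Ω) :=
          (ha2.1.sub hm0.1).pow 2
        rw [hv0, integral_eq_lintegral_of_nonneg_ae (ae_of_all _ fun x => sq_nonneg _) hm2,
          ← eLpNorm_two_sq]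
        have h1 : eLpNorm (fun x => G t₀ x - u 0 x) 2 (volume.restrict Ω) ≤ ENNReal.ofReal δ := by
          refine le_trans (le_of_eq (eLpNorm_congr_ae ?_)) hδt.le
          filter_upwards [hGtΩ] with x hx
          simp [hx]
        rw [ENNReal.toReal_pow]
        exact pow_le_pow_left₀ ENNReal.toReal_nonneg (ENNReal.toReal_le_of_le_ofReal hδ.le h1) 2
      have hend : 0 ≤ ∫ x in Ω, (v T x - u T x) ^ 2 := integral_nonneg fun x => sq_nonneg _
      linarith
    -- Here h → 0 with δ and t₀ fixed. The order matters, since the energy of u(t₀) need not stay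
    -- bounded as δ → 0.
    exact le_of_forall_pos_le_add_mul step
  rw [hgE]
  have hfin : (timeEnergy H T u).toReal ≤ (timeEnergy H T g).toReal - I :=
    le_of_forall_pos_le_add_mul (c := 1 / 2) fun r hr => by
      -- The choice δ = √r makes the error linear in r.
      have := approx (√r) (Real.sqrt_pos.2 hr)
      rw [Real.sq_sqrt hr.le] at this
      linarith
  linarith

/-- Every variational solution is a parabolic minimizer. -/
theorem IsVariationalSolution.isParabolicMinimizer {N : ℕ} {Ω : Set (Space N)}
    (hΩ : MeasurableSet Ω) {s p A : ℝ} (hp : 1 ≤ p) (hA : 0 < A)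
    {H : Space N → Space N → ℝ → ℝ} (hH : StructureCondition s p A H)
    {u₀ : Space N → ℝ} (hu₀ : IsAdmissibleDatum Ω s p H u₀)
    {u : ℝ → Space N → ℝ} (hu : IsVariationalSolution Ω s p H u₀ u) :
    IsParabolicMinimizer Ω s p H u₀ u := by
  refine ⟨?_, hu.memLpSobolev, hu.boundary, fun T hT φ hφ => ?_⟩
  -- Measurability on the infinite cylinder follows from the countably many cylinders over (0,n+1);
  -- the shift by 1 keeps the length positive at n = 0.
  · have hU : (Ioi (0 : ℝ)) ×ˢ (univ : Set (Space N)) =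
        ⋃ n : ℕ, Ioo (0 : ℝ) (n + 1) ×ˢ (univ : Set (Space N)) := by
      ext ⟨t, x⟩
      simp only [mem_prod, mem_Ioi, mem_univ, and_true, mem_iUnion, mem_Ioo]
      refine ⟨fun h => ?_, fun ⟨_, h⟩ => h.1⟩
      obtain ⟨n, hn⟩ := exists_nat_gt t
      exact ⟨n, h, by linarith⟩
    have hrestrict : ((volume : Measure ℝ).restrict (Ioi 0)).prod (volume : Measure (Space N)) =
        ((volume : Measure ℝ).prod (volume : Measure (Space N))).restrict (Ioi 0 ×ˢ univ) := by
      rw [← Measure.prod_restrict, Measure.restrict_univ]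
    rw [hrestrict, hU, aestronglyMeasurable_iUnion_iff]
    intro n
    have := (hu.memLpSobolev (n + 1) (by positivity)).aestronglyMeasurable
    rwa [cylinderMeasure, Measure.prod_restrict] at this
  · have huE := hu.timeEnergy_lt_top hp hu₀ hT
    by_cases hE : timeEnergy H T (fun t x => u t x + φ t x) = ⊤
    · rw [hE, EReal.coe_ennreal_top]; exact le_top
    · have h := hu.minimality hΩ hp hA hH hu₀ hT hφ (lt_top_iff_ne_top.2 hE)
      rw [← EReal.coe_ennreal_toReal huE.ne, ← EReal.coe_ennreal_toReal hE, ← EReal.coe_add,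
        EReal.coe_le_coe_iff]
      exact h

end NonlocalEvolution

end

theorem mainTheorem3 (N : ℕ) (hN : 1 ≤ N)
    (Ω : Set (NonlocalEvolution.Space N)) (hΩ_open : IsOpen Ω) (hΩ_bdd : Bornology.IsBounded Ω)
    (s p A : ℝ) (hs0 : 0 < s) (hs1 : s < 1) (hp : 1 < p) (hA : 0 < A)
    (H : NonlocalEvolution.Space N → NonlocalEvolution.Space N → ℝ → ℝ)
    (hH : NonlocalEvolution.StructureCondition s p A H)
    (u₀ : NonlocalEvolution.Space N → ℝ)
    (hu₀ : NonlocalEvolution.IsAdmissibleDatum Ω s p H u₀)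
    (u : ℝ → NonlocalEvolution.Space N → ℝ)
    (hu : NonlocalEvolution.IsVariationalSolution Ω s p H u₀ u) :
    NonlocalEvolution.IsParabolicMinimizer Ω s p H u₀ u := 
  hu.isParabolicMinimizer hΩ_open.measurableSet hp.le hA hH hu₀
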